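/- Let $r\ge 1$ and let $1\le k\le n$ be integers. **Words and colored ordered multiset partitions.** An $r$-colored letter is $i^c$ with $i\in\mathbb Z_{>0}$ and color $c\in\{0,\dots,r-1\}$. Order the letters by $1^{r-1}<2^{r-1}<\cdots<1^{r-2}<2^{r-2}<\cdots<1^0<2^0<\cdots$. For a word $w=w_1\cdots w_n$ of $r$-colored letters let $\mathrm{Des}(w)=\{1\le i\le n-1: w_i>w_{i+1}\}$. An $r$-colored ordered multiset partition $\mu=(M_1,\dots,M_k)$ of size $n$ with $k$ blocks is a sequence of $k$ finite nonempty sets of $r$-colored letters with $|M_1|+\cdots+|M_k|=n$. Let $w$ be the word obtained by writing each block in decreasing order and concatenating the blocks, let $S$ be the set of $1\le i\le n-1$ such that positions $i$ and $i+1$ of $w$ belong to the same block, and let $c(\mu)$ be the sum of all colors. Put $$\mathrm{maj}(\mu)=c(\mu)+r\Big[\sum_{i\in\mathrm{Des}(w)}i-\sum_{i\in S}\big|\mathrm{Des}(w)\cap\{i,i+1,\dots,n\}\big|\Big].$$ **Symmetric functions.** Let $\mathbf x=(\mathbf x^{(1)},\dots,\mathbf x^{(r)})$ with $\mathbf x^{(i)}=(x^{(i)}_1,x^{(i)}_2,\dots)$,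 and let $\Lambda^r(\mathbf x)$ be the space of formal power series of bounded degree which are symmetric in each of $\mathbf x^{(1)},\dots,\mathbf x^{(r)}$ separately. For an $r$-tuple of partitions $\boldsymbol\lambda=(\lambda^{(1)},\dots,\lambda^{(r)})$ let $\boldsymbol\lambda'$ be its componentwise conjugate and $\boldsymbol s_{\boldsymbol\lambda}(\mathbf x)=s_{\lambda^{(1)}}(\mathbf x^{(1)})\cdots s_{\lambda^{(r)}}(\mathbf x^{(r)})$. Let $\omega$ be the linear map on $\Lambda^r(\mathbf x)$ with $\omega(\boldsymbol s_{\boldsymbol\lambda})=\boldsymbol s_{\boldsymbol\lambda'}$ for all $\boldsymbol\lambda$, extended linearly over scalars in $q$. Let $\mathrm{rev}_q$ be the operator which reverses the coefficient sequence of a polynomial in $q$: $\mathrm{rev}_q P(q)=q^{\deg P}P(q^{-1})$. Define $$\boldsymbol M_{n,k}(\mathbf x;q)=\sum_\mu q^{\mathrm{maj}(\mu)}\mathbf x^\mu,\qquad \boldsymbol D_{n,k}(\mathbf x;q)=(\mathrm{rev}_q\circ\omega)\,\boldsymbol M_{n,k}(\mathbf x;q),$$ where $\mu$ ranges over the $r$-colored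 ordered multiset partitions of size $n$ with $k$ blocks, and the exponent of $x^{(i)}_j$ in $\mathbf x^\mu$ is the number of occurrences of $j^{i-1}$ in $\mu$. **Tableaux.** Let $\mathrm{SYT}^r(n)$ be the set of $r$-tuples $\boldsymbol T=(T^{(1)},\dots,T^{(r)})$ of fillings of partition shapes (possibly empty, English notation), increasing along rows and down columns, in which each of $1,\dots,n$ appears exactly once in total and nothing else appears. A number $1\le i\le n-1$ is a descent of $\boldsymbol T$ if $i+1$ lies in a component strictly to the right of the one containing $i$, or in the same component in a row below $i$. Let $\mathrm{Des}(\boldsymbol T)$ be the set of descents, $\mathrm{des}(\boldsymbol T)$ its cardinality, and $\mathrm{maj}(\boldsymbol T)=r\sum_{i\in\mathrm{Des}(\boldsymbol T)}i+\sum_{j=1}^r(j-1)|T^{(j)}|$. **Proposition.** The coefficients of $\boldsymbol M_{n,k}(\mathbf x;q)$ as a polynomial in $q$ lie in $\Lambda^r(\mathbf x)$ (so that $\boldsymbol D_{n,k}$ is well defined), and $$\boldsymbol D_{n,k}(\mathbf x;q)=\mathrm{rev}_q\Bigg[\sum_{\boldsymbol T\in\mathrm{SYT}^r(n)}q^{\mathrm{maj}(\boldsymbol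 T)+r\binom{n-k}{2}-r(n-k)\mathrm{des}(\boldsymbol T)}\begin{bmatrix}\mathrm{des}(\boldsymbol T)\\ n-k\end{bmatrix}_{q^r}\boldsymbol s_{\mathrm{shape}(\boldsymbol T)'}(\mathbf x)\Bigg],$$ where $\begin{bmatrix}m\\a\end{bmatrix}_q=\frac{[m]!_q}{[a]!_q[m-a]!_q}$ is the $q$-binomial coefficient, equal to $0$ if $a>m$. In particular $\boldsymbol D_{n,k}(\mathbf x;q)$ is Schur positive: it is a finite linear combination of the $\boldsymbol s_{\boldsymbol\lambda}(\mathbf x)$ with coefficients in $\mathbb Z_{\ge0}[q]$. -/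

import Mathlib

open Polynomial

noncomputable section

/-- The alphabet of `r`-coloured letters, with the order that weights colours more heavily than
letter values, higher colours being smaller:
`1^{r-1} < 2^{r-1} < ⋯ < 1^{r-2} < 2^{r-2} < ⋯ < 1^0 < 2^0 < ⋯`.
It is the lexicographic order on pairs (colour, value) with the colours reversed.  Values are
indexed from `0`, so that the value `j : ℕ` stands for the positive integer `j + 1`. -/
abbrev ColoredLetter (r : ℕ) : Type := (Fin r)ᵒᵈ ×ₗ ℕ

/-- The colour `c ∈ {0, …, r-1}` of a coloured letter. -/
def ColoredLetter.color {r : ℕ} (a : ColoredLetter r) : Fin r := OrderDual.ofDual (ofLex a).1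

/-- The (zero-based) value of a coloured letter. -/
def ColoredLetter.value {r : ℕ} (a : ColoredLetter r) : ℕ := (ofLex a).2

/-- The index set of the variables `x^{(i)}_j`: the pair `(i, j)`, both entries counted from `0`,
stands for `x^{(i+1)}_{j+1}`. -/
abbrev VarIndex (r : ℕ) : Type := Fin r × ℕ

/-- An `r`-coloured ordered multiset partition of size `n` with `k` blocks: a sequence of `k`
finite nonempty sets of coloured letters whose cardinalities add up to `n`. -/
structure ColoredOMP (r n k : ℕ) where
  block : Fin k → Finset (ColoredLetter r)
  nonempty : ∀ i, (block i).Nonempty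
  size : ∑ i, (block i).card = n

/-- Descent set of a word `w = w_1 … w_m` of coloured letters: the set of those `1 ≤ i ≤ m - 1`
with `w_i > w_{i+1}`.  (The letter `w_i` is the list entry with index `i - 1`.) -/
def wordDes {r : ℕ} (w : List (ColoredLetter r)) : Finset ℕ := by
  classical
  exact (Finset.Ico 1 w.length).filter
    (fun i => ∃ a b, w[i - 1]? = some a ∧ w[i]? = some b ∧ b < a)

namespace ColoredOMP

variable {r n k : ℕ}

/-- The word underlying the descent starred notation: the blocks are concatenated, each of them
written in decreasing order. -/
def word (μ : ColoredOMP r n k) : List (ColoredLetter r) :=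
  (List.ofFn (fun i => (μ.block i).sort (fun a b => b ≤ a))).flatten

/-- The set `S` of starred positions: those `1 ≤ i ≤ n - 1` for which the `i`-th and the
`(i+1)`-st letters of the word are in the same block, which means that `i` is not the total size
of the first `j` blocks for any `j`. -/
def stars (μ : ColoredOMP r n k) : Finset ℕ := by
  classical
  exact (Finset.Ico 1 n).filter
    (fun i => ∀ j : ℕ, j ≤ k →
      i ≠ ∑ t ∈ Finset.univ.filter (fun t : Fin k => t.val < j), (μ.block t).card)

/-- The sum of the colours of all letters. -/
def colorSum (μ : ColoredOMP r n k) : ℕ := ∑ i, ∑ a ∈ μ.block i, (a.color : ℕ)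

/-- The major index
`c(μ) + r * (∑_{i ∈ Des w} i - ∑_{i ∈ S} |Des w ∩ {i, i+1, …, n}|)`, where `(w, S)` is the descent
starred representation of `μ`.  The subtraction never truncates: as `S ⊆ Des w`, the second sum is
at most `1 + 2 + ⋯ + |Des w|`, which is at most the first. -/
def maj (μ : ColoredOMP r n k) : ℕ :=
  μ.colorSum +
    r * (∑ i ∈ wordDes μ.word, i -
      ∑ i ∈ μ.stars, ((wordDes μ.word).filter (fun d => i ≤ d)).card)

/-- The exponent vector of `x^μ`: the exponent of `x^{(i)}_j` is the number of occurrences of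
`j^{i-1}` in `μ`. -/
def weight (μ : ColoredOMP r n k) : VarIndex r →₀ ℕ :=
  ∑ i, ∑ a ∈ μ.block i, Finsupp.single (a.color, a.value) 1

end ColoredOMP

/-- The coefficient of `q^d` in `M_{n,k}(x;q) = ∑_μ q^{maj μ} x^μ`: the formal power series in
which the coefficient of the monomial `x^m` is the (finite) number of `r`-coloured ordered multiset
partitions `μ` of size `n` with `k` blocks such that `maj μ = d` and `x^μ = x^m`. -/
def MCoeff (r n k d : ℕ) : MvPowerSeries (VarIndex r) ℚ :=
  fun m => (Nat.card {μ : ColoredOMP r n k // μ.maj = d ∧ μ.weight = m} : ℚ)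

/-- `M_{n,k}(x;q)`, as a polynomial in `q` whose coefficients are power series in `x`.  Only
finitely many terms are nonzero, as `maj μ ≤ n * r + r * n ^ 2`. -/
def MSeries (r n k : ℕ) : (MvPowerSeries (VarIndex r) ℚ)[X] :=
  ∑ᶠ d : ℕ, monomial d (MCoeff r n k d)

/-- `Λ^r(x)`: the formal power series of bounded degree that are symmetric in each of the `r`
variable sets `x^{(1)}, …, x^{(r)}` separately. -/
def SymmR (r : ℕ) : Submodule ℚ (MvPowerSeries (VarIndex r) ℚ) where
  carrier := {F |
    (∃ N : ℕ, ∀ m : VarIndex r →₀ ℕ, MvPowerSeries.coeff m F ≠ 0 → m.degree ≤ N) ∧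
    ∀ (g : Fin r → Equiv.Perm ℕ) (m : VarIndex r →₀ ℕ),
      MvPowerSeries.coeff (m.mapDomain (fun p => (p.1, g p.1 p.2))) F = MvPowerSeries.coeff m F}
  zero_mem' := ⟨⟨0, fun m h => absurd (by simp) h⟩, fun g m => by simp⟩
  add_mem' := by
    rintro F G ⟨⟨N, hN⟩, hF⟩ ⟨⟨N', hN'⟩, hG⟩
    refine ⟨⟨max N N', fun m h => ?_⟩, fun g m => by simp [hF g m, hG g m]⟩
    by_cases h1 : MvPowerSeries.coeff m F = 0
    · refine (hN' m fun h2 => h (by simp [h1, h2])).trans (le_max_right _ _)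
    · exact (hN m h1).trans (le_max_left _ _)
  smul_mem' := by
    rintro c F ⟨⟨N, hN⟩, hF⟩
    refine ⟨⟨N, fun m h => hN m fun h1 => h (by simp [h1])⟩, fun g m => by simp [hF g m]⟩

/-- The exponent vector of `x^T` for a semistandard `r`-tableau `T`: the exponent of `x^{(i)}_j` is
the multiplicity of `j` in `T^{(i)}` (both counted from `0`). -/
def tableauWeight {r : ℕ} {lam : Fin r → YoungDiagram}
    (T : ∀ i, SemistandardYoungTableau (lam i)) : VarIndex r →₀ ℕ :=
  ∑ i, ∑ c ∈ (lam i).cells, Finsupp.single (i, T i c.1 c.2) 1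

/-- The Schur function `s_λ(x) = s_{λ^{(1)}}(x^{(1)}) ⋯ s_{λ^{(r)}}(x^{(r)}) = ∑_T x^T` of an
`r`-partition `λ`, the sum being over all semistandard `r`-tableaux of shape `λ`. -/
def schur {r : ℕ} (lam : Fin r → YoungDiagram) : MvPowerSeries (VarIndex r) ℚ :=
  fun m => (Nat.card
    {T : ∀ i, SemistandardYoungTableau (lam i) // tableauWeight T = m} : ℚ)

/-- The componentwise conjugate of an `r`-partition. -/
def conj {r : ℕ} (lam : Fin r → YoungDiagram) : Fin r → YoungDiagram :=
  fun i => (lam i).transpose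

/-- The defining property of the involution `ω`: it sends `s_λ` to `s_{λ'}` for all
`r`-partitions `λ`. -/
def IsOmega (r : ℕ) (w : SymmR r →ₗ[ℚ] SymmR r) : Prop :=
  ∀ lam : Fin r → YoungDiagram,
    ∃ h : schur lam ∈ SymmR r, (w ⟨schur lam, h⟩ : MvPowerSeries (VarIndex r) ℚ) = schur (conj lam)

open Classical in
/-- The linear map `ω : Λ^r(x) → Λ^r(x)` which sends `s_λ` to `s_{λ'}` for all `r`-partitions `λ`.
(It exists and is unique because the Schur functions are a basis of `Λ^r(x)`.) -/
def omega (r : ℕ) : SymmR r →ₗ[ℚ] SymmR r :=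
  if h : ∃ w, IsOmega r w then h.choose else 0

open Classical in
/-- `ω` on power series; the value outside `Λ^r(x)` is irrelevant. -/
def omegaSeries (r : ℕ) (F : MvPowerSeries (VarIndex r) ℚ) : MvPowerSeries (VarIndex r) ℚ :=
  if h : F ∈ SymmR r then (omega r ⟨F, h⟩ : MvPowerSeries (VarIndex r) ℚ) else 0

/-- `ω` on polynomials in `q`, coefficient by coefficient (`ω` is linear over scalars in `q`). -/
def omegaQ (r : ℕ) (P : (MvPowerSeries (VarIndex r) ℚ)[X]) : (MvPowerSeries (VarIndex r) ℚ)[X] :=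
  ∑ d ∈ P.support, monomial d (omegaSeries r (P.coeff d))

/-- The operator which reverses the coefficient sequence of a polynomial in `q`,
`P(q) ↦ q^{deg P} P(q⁻¹)`. -/
def revQ {R : Type*} [Semiring R] (P : R[X]) : R[X] := P.reverse

/-- `D_{n,k}(x;q) = (rev_q ∘ ω) M_{n,k}(x;q)`. -/
def DSeries (r n k : ℕ) : (MvPowerSeries (VarIndex r) ℚ)[X] :=
  revQ (omegaQ r (MSeries r n k))

/-- The cells of an `r`-tuple of Young diagrams, as triples (component, row, column). -/
def rCells {r : ℕ} (lam : Fin r → YoungDiagram) : Set (Fin r × ℕ × ℕ) :=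
  {p | p.2 ∈ lam p.1}

/-- `SYT^r(n)`: standard tableaux with `r` components and `n` boxes, i.e. semistandard
`r`-tableaux in which each of the entries `1, …, n` appears precisely once and nothing else
appears. -/
structure StdRTableau (r n : ℕ) where
  shape : Fin r → YoungDiagram
  tab : ∀ i, SemistandardYoungTableau (shape i)
  standard : Set.BijOn (fun p : Fin r × ℕ × ℕ => tab p.1 p.2.1 p.2.2) (rCells shape) (Set.Icc 1 n)

namespace StdRTableau

variable {r n : ℕ}

/-- `i ∈ {1, …, n - 1}` is a descent if `i + 1` lies in a component strictly to the right of the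
component of `i`, or in the same component and in a row below that of `i`. -/
def Des (T : StdRTableau r n) : Finset ℕ := by
  classical
  exact (Finset.Ico 1 n).filter
    (fun i => ∃ p ∈ rCells T.shape, ∃ p' ∈ rCells T.shape,
      T.tab p.1 p.2.1 p.2.2 = i ∧ T.tab p'.1 p'.2.1 p'.2.2 = i + 1 ∧
        (p.1 < p'.1 ∨ (p.1 = p'.1 ∧ p.2.1 < p'.2.1)))

/-- The number of descents. -/
def des (T : StdRTableau r n) : ℕ := T.Des.card

/-- The major index `r * ∑_{i ∈ Des T} i + ∑_j (j - 1) |T^{(j)}|` (here `j` counts from `0`). -/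
def maj (T : StdRTableau r n) : ℕ :=
  r * ∑ i ∈ T.Des, i + ∑ j : Fin r, (j : ℕ) * (T.shape j).card

theorem cell_lt (T : StdRTableau r n) {i : Fin r} {a b : ℕ} (h : (a, b) ∈ T.shape i) :
    a < n ∧ b < n := by
  have key : ∀ (m : ℕ) (f : ℕ → ℕ × ℕ), Function.Injective f →
      (∀ x ≤ m, f x ∈ T.shape i) → m < n := by
    intro m f hf hm
    have h1 : (Finset.range (m + 1)).card ≤ (Finset.Icc 1 n).card := by
      refine Finset.card_le_card_of_injOn (fun x => T.tab i (f x).1 (f x).2) ?_ ?_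
      · intro x hx
        have hx' : f x ∈ T.shape i := hm x (by simpa [Nat.lt_succ_iff] using hx)
        have := T.standard.mapsTo (show ((i, f x) : Fin r × ℕ × ℕ) ∈ rCells T.shape from hx')
        simpa using this
      · intro x hx y hy hxy
        have hx' : f x ∈ T.shape i := hm x (by simpa [Nat.lt_succ_iff] using hx)
        have hy' : f y ∈ T.shape i := hm y (by simpa [Nat.lt_succ_iff] using hy)
        have := T.standard.injOn (show ((i, f x) : Fin r × ℕ × ℕ) ∈ rCells T.shape from hx')
          (show ((i, f y) : Fin r × ℕ × ℕ) ∈ rCells T.shape from hy') hxy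
        exact hf (Prod.ext_iff.1 this).2
    simp at h1
    omega
  constructor
  · exact key a (fun x => (x, b)) (fun x y hxy => (Prod.ext_iff.1 hxy).1)
      (fun x hx => (T.shape i).up_left_mem hx le_rfl h)
  · exact key b (fun x => (a, x)) (fun x y hxy => (Prod.ext_iff.1 hxy).2)
      (fun x hx => (T.shape i).up_left_mem le_rfl hx h)

/-- `SYT^r(n)` is a finite set. -/
instance finite_stdRTableau (r n : ℕ) : Finite (StdRTableau r n) := by
  let Φ : StdRTableau r n → Set (Fin r × Fin n × Fin n × Fin (n + 1)) := fun T =>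
    {p | ((p.2.1 : ℕ), (p.2.2.1 : ℕ)) ∈ T.shape p.1 ∧ T.tab p.1 p.2.1 p.2.2.1 = p.2.2.2}
  refine Finite.of_injective Φ ?_
  have sub : ∀ T T' : StdRTableau r n, Φ T = Φ T' → ∀ (i : Fin r) (a b : ℕ),
      (a, b) ∈ T.shape i → (a, b) ∈ T'.shape i ∧ T.tab i a b = T'.tab i a b := by
    intro T T' hT i a b hab
    obtain ⟨ha, hb⟩ := T.cell_lt hab
    have hv := T.standard.mapsTo (show ((i, (a, b)) : Fin r × ℕ × ℕ) ∈ rCells T.shape from hab)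
    have hv' : T.tab i a b < n + 1 := Nat.lt_succ_of_le hv.2
    have hmem : ((i, ⟨a, ha⟩, ⟨b, hb⟩, ⟨T.tab i a b, hv'⟩) :
        Fin r × Fin n × Fin n × Fin (n + 1)) ∈ Φ T := ⟨hab, rfl⟩
    rw [hT] at hmem
    exact ⟨hmem.1, hmem.2.symm⟩
  intro T T' hT
  have hs : T.shape = T'.shape := by
    funext i
    ext ⟨a, b⟩
    exact ⟨fun h => (sub T T' hT i a b h).1, fun h => (sub T' T hT.symm i a b h).1⟩
  have ht : ∀ i a b, T.tab i a b = T'.tab i a b := by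
    intro i a b
    by_cases h : (a, b) ∈ T.shape i
    · exact (sub T T' hT i a b h).2
    · have h' : (a, b) ∉ T'.shape i := by rwa [← hs]
      rw [(T.tab i).zeros h, (T'.tab i).zeros h']
  obtain ⟨s, t, h⟩ := T
  obtain ⟨s', t', h'⟩ := T'
  obtain rfl : s = s' := hs
  obtain rfl : t = t' := by
    funext i
    exact SemistandardYoungTableau.ext (ht i)
  rfl

end StdRTableau

/-- The `q`-integer `[m]_q = 1 + q + ⋯ + q^{m-1}`. -/
def qInt (m : ℕ) : ℚ[X] := ∑ i ∈ Finset.range m, X ^ i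

/-- The `q`-factorial `[m]!_q = [m]_q ⋯ [1]_q`. -/
def qFact (m : ℕ) : ℚ[X] := ∏ i ∈ Finset.range m, qInt (i + 1)

/-- The `q`-binomial coefficient `[m]!_q / ([a]!_q [m-a]!_q)` (the division of polynomials is
exact), which is `0` for `a > m`. -/
def qBinom (m a : ℕ) : ℚ[X] := if a ≤ m then qFact m / (qFact a * qFact (m - a)) else 0

/-- The polynomial `q^{maj T + r * C(n-k,2) - r (n-k) des T} [des T choose n-k]_{q^r}`.  The
subtraction in the exponent never truncates, as `maj T ≥ r * (1 + 2 + ⋯ + des T)`. -/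
def tableauPoly {r n : ℕ} (k : ℕ) (T : StdRTableau r n) : ℚ[X] :=
  X ^ (T.maj + r * (n - k).choose 2 - r * (n - k) * T.des) * (qBinom T.des (n - k)).comp (X ^ r)

/-- The polynomial `∑_{T ∈ SYT^r(n)} q^{…} [des T choose n-k]_{q^r} s_{shape(T)'}(x)` in `q`;
`SYT^r(n)` is a finite set. -/
def tableauSum (r n k : ℕ) : (MvPowerSeries (VarIndex r) ℚ)[X] :=
  ∑ᶠ T : StdRTableau r n,
    (tableauPoly k T).map (algebraMap ℚ (MvPowerSeries (VarIndex r) ℚ)) * C (schur (conj T.shape))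

/-- Schur positivity of a polynomial in `q` over power series: it is a linear combination of
finitely many Schur functions with coefficients in `ℤ_{≥ 0}[q]`. -/
def SchurPositive {r : ℕ} (P : (MvPowerSeries (VarIndex r) ℚ)[X]) : Prop :=
  ∃ c : (Fin r → YoungDiagram) →₀ ℕ[X],
    P = c.sum (fun lam p => p.map (Nat.castRingHom (MvPowerSeries (VarIndex r) ℚ)) * C (schur lam))

end

/-!
Concatenating the blocks of an ordered multiset partition, each written in decreasing order, gives a
word `w` together with a set `S ⊆ Des(w)` of `n - k` positions, the junctions inside the blocks, and
every such pair arises once. The coefficient of `x^m` in `M_{n,k}` is therefore a sum, over the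
words `w` of content `m`, of a quantity depending only on `Des(w)`.

The words of content `m` are regrouped by standard tableaux. Fix a set `D` and count words with
descent set contained in `D`: such a word is weakly increasing between consecutive elements of `D`,
and removing its last run gives a recursion. By the Pieri rule, the sum over `λ` of the number of
Yamanouchi words of content `λ` with descents in `D`, times the coefficient of `x^m` in `s_λ`,
satisfies the same recursion. Möbius inversion over `D` passes to exact descent sets, and Yamanouchi
words of content `λ` are the standard tableaux of shape `λ`: the `i`-th letter records the component
and row which contain `i`.

For a fixed descent set the sum over `S` is a `q`-binomial coefficient, by the `q`-binomial theorem.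
This is the Schur expansion of `M_{n,k}`. Schur functions are symmetric, by the Pieri rule and
induction on the last row of the shape, and linearly independent, since `x^ν` occurs in `s_μ` with
`μ ≠ ν` only if `∑ i * μ_i < ∑ i * ν_i`. Hence `ω` conjugates each shape in the expansion.
-/

section YoungDiagrams

open YoungDiagram

theorem rowLen_injective : Function.Injective rowLen := by
  intro μ ν h
  ext ⟨i, j⟩
  rw [mem_cells, mem_cells, mem_iff_lt_rowLen, mem_iff_lt_rowLen, h]

theorem exists_rowLen_eq {f : ℕ → ℕ} (hf : Antitone f) {N : ℕ} (hN : f N = 0) :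
    ∃ μ : YoungDiagram, μ.rowLen = f := by
  have sorted : ((List.range N).map f).SortedGE :=
    List.Pairwise.sortedGE (List.pairwise_map.2 (List.pairwise_lt_range.imp fun h => hf h.le))
  refine ⟨ofRowLens _ sorted, funext fun i => eq_of_forall_lt_iff fun j => ?_⟩
  rw [← mem_iff_lt_rowLen, mem_ofRowLens]
  simp only [List.length_map, List.length_range, List.getElem_map, List.getElem_range,
    exists_prop, and_iff_right_iff_imp]
  intro hj
  by_contra hi
  have := hf (not_lt.1 hi)
  omega

theorem rowLen_le_card (μ : YoungDiagram) (i : ℕ) : μ.rowLen i ≤ μ.card := by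
  rw [rowLen_eq_card]
  exact Finset.card_le_card (Finset.filter_subset _ _)

theorem colLen_le_card (μ : YoungDiagram) (j : ℕ) : μ.colLen j ≤ μ.card := by
  rw [colLen_eq_card]
  exact Finset.card_le_card (Finset.filter_subset _ _)

theorem rowLen_eq_zero {μ : YoungDiagram} {N : ℕ} (h : μ.card ≤ N) : μ.rowLen N = 0 := by
  by_contra hpos
  have hcol := mem_iff_lt_colLen.1 (mem_iff_lt_rowLen.2 (Nat.pos_of_ne_zero hpos))
  exact absurd (hcol.trans_le (colLen_le_card μ 0)) (not_lt.2 h)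

theorem rowLen_eq_zero_of_le {μ : YoungDiagram} {N i : ℕ} (h : μ.rowLen N = 0) (hi : N ≤ i) :
    μ.rowLen i = 0 :=
  Nat.le_zero.1 ((μ.rowLen_anti N i hi).trans_eq h)

theorem card_eq_sum_rowLen {μ : YoungDiagram} {N : ℕ} (h : μ.rowLen N = 0) :
    μ.card = ∑ i ∈ Finset.range N, μ.rowLen i := by
  simp only [rowLen_eq_card]
  refine Finset.card_eq_sum_card_fiberwise (f := Prod.fst) ?_
  rintro ⟨i, j⟩ hc
  rw [Finset.mem_coe, mem_cells, mem_iff_lt_rowLen] at hc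
  by_contra hi
  have := μ.rowLen_anti N i (by simpa using hi)
  omega

theorem card_mono {ν μ : YoungDiagram} (h : ν ≤ μ) : ν.card ≤ μ.card :=
  Finset.card_le_card (cells_subset_iff.2 h)

theorem finite_setOf_card_le (M : ℕ) : {μ : YoungDiagram | μ.card ≤ M}.Finite := by
  refine Set.Finite.of_finite_image (f := cells) ?_ fun μ _ ν _ h => YoungDiagram.ext h
  refine (Finset.finite_toSet (Finset.range M ×ˢ Finset.range M).powerset).subset ?_
  rintro _ ⟨μ, hμ, rfl⟩
  refine Finset.mem_coe.2 (Finset.mem_powerset.2 fun ⟨i, j⟩ hc => ?_)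
  rw [mem_cells] at hc
  rw [Finset.mem_product, Finset.mem_range, Finset.mem_range]
  exact ⟨((mem_iff_lt_colLen.1 hc).trans_le (colLen_le_card μ j)).trans_le hμ,
    ((mem_iff_lt_rowLen.1 hc).trans_le (rowLen_le_card μ i)).trans_le hμ⟩

/-- The finset of Young diagrams with at most `M` cells. It makes the sums over all diagrams below
finite; their summands vanish on diagrams with too many cells. -/
noncomputable def cardLE (M : ℕ) : Finset YoungDiagram := (finite_setOf_card_le M).toFinset

theorem mem_cardLE {M : ℕ} {μ : YoungDiagram} : μ ∈ cardLE M ↔ μ.card ≤ M := by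
  simp [cardLE]

/-- `IsHStrip ν μ` says that `ν ⊆ μ` and that the skew diagram `μ / ν` is a horizontal strip, i.e.
has at most one cell in each column; it is encoded as the interlacing of the row lengths. -/
def IsHStrip (ν μ : YoungDiagram) : Prop :=
  ∀ i, μ.rowLen (i + 1) ≤ ν.rowLen i ∧ ν.rowLen i ≤ μ.rowLen i

namespace IsHStrip

variable {ν μ : YoungDiagram}

theorem refl (μ : YoungDiagram) : IsHStrip μ μ :=
  fun i => ⟨μ.rowLen_anti i (i + 1) i.le_succ, le_rfl⟩

theorem le (h : IsHStrip ν μ) : ν ≤ μ := by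
  rintro ⟨i, j⟩ hc
  exact mem_iff_lt_rowLen.2 ((mem_iff_lt_rowLen.1 hc).trans_le (h i).2)

theorem card_le (h : IsHStrip ν μ) : ν.card ≤ μ.card :=
  card_mono h.le

theorem mem_of_lt (h : IsHStrip ν μ) {i i' j : ℕ} (hi : i < i') (hc : (i', j) ∈ μ) :
    (i, j) ∈ ν := by
  rw [mem_iff_lt_rowLen] at hc ⊢
  exact (hc.trans_le (μ.rowLen_anti (i + 1) i' hi)).trans_le (h i).1

end IsHStrip

/-- The correspondence between the diagrams `μ` with `μ / ν` and `μ / κ` horizontal strips and the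
diagrams `τ` with `ν / τ` and `κ / τ` horizontal strips. Both `μ.rowLen (i + 1)` and `τ.rowLen i`
range over the interval from `max (ν.rowLen (i + 1)) (κ.rowLen (i + 1))` to
`min (ν.rowLen i) (κ.rowLen i)`, and they correspond to each other under its reflection. -/
def StripReflection (ν κ μ τ : YoungDiagram) : Prop :=
  ∀ i, μ.rowLen (i + 1) + τ.rowLen i =
    min (ν.rowLen i) (κ.rowLen i) + max (ν.rowLen (i + 1)) (κ.rowLen (i + 1))

namespace StripReflection

variable {ν κ μ τ : YoungDiagram}

theorem card_add_card (h : StripReflection ν κ μ τ) :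
    μ.card + τ.card + max (ν.rowLen 0) (κ.rowLen 0) = ν.card + κ.card + μ.rowLen 0 := by
  have partial_sums : ∀ n, ∑ i ∈ Finset.range (n + 1), μ.rowLen i +
      ∑ i ∈ Finset.range n, τ.rowLen i + max (ν.rowLen 0) (κ.rowLen 0) +
        min (ν.rowLen n) (κ.rowLen n) =
      ∑ i ∈ Finset.range (n + 1), ν.rowLen i + ∑ i ∈ Finset.range (n + 1), κ.rowLen i +
        μ.rowLen 0 := by
    intro n
    induction n with
    | zero => simp only [Finset.sum_range_succ, Finset.sum_range_zero]; omega
    | succ n ih =>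
      have := h n
      rw [Finset.sum_range_succ, Finset.sum_range_succ τ.rowLen, Finset.sum_range_succ ν.rowLen,
        Finset.sum_range_succ κ.rowLen]
      omega
  set n := μ.card + τ.card + ν.card + κ.card
  have total := partial_sums n
  rw [← card_eq_sum_rowLen (μ := μ) (rowLen_eq_zero (by omega)),
    ← card_eq_sum_rowLen (μ := τ) (rowLen_eq_zero (by omega)),
    ← card_eq_sum_rowLen (μ := ν) (rowLen_eq_zero (by omega)),
    ← card_eq_sum_rowLen (μ := κ) (rowLen_eq_zero (by omega)),
    rowLen_eq_zero (μ := ν) (N := n) (by omega), Nat.zero_min] at total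
  exact total

theorem eq_left {μ' : YoungDiagram} (h : StripReflection ν κ μ τ)
    (h' : StripReflection ν κ μ' τ) (hcard : μ.card = μ'.card) : μ = μ' := by
  refine rowLen_injective (funext fun i => ?_)
  cases i with
  | zero => have := h.card_add_card; have := h'.card_add_card; omega
  | succ i => have := h i; have := h' i; omega

end StripReflection

theorem exists_stripReflection_lower {ν κ μ : YoungDiagram} (hν : IsHStrip ν μ)
    (hκ : IsHStrip κ μ) : ∃ τ, StripReflection ν κ μ τ ∧ IsHStrip τ ν ∧ IsHStrip τ κ := by
  have hanti : Antitone fun i => min (ν.rowLen i) (κ.rowLen i) +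
      max (ν.rowLen (i + 1)) (κ.rowLen (i + 1)) - μ.rowLen (i + 1) := by
    refine antitone_nat_of_succ_le fun i => ?_
    grind [hν i, hκ i, hν (i + 1), hκ (i + 1), hν (i + 2), hκ (i + 2)]
  obtain ⟨τ, hτ⟩ := exists_rowLen_eq hanti (N := ν.card)
    (by have := rowLen_eq_zero le_rfl (μ := ν); have := hν ν.card; have := hκ ν.card
        have := hν (ν.card + 1); have := hκ (ν.card + 1)
        omega)
  have hrow i := congrFun hτ i
  refine ⟨τ, fun i => ?_, fun i => ?_, fun i => ?_⟩ <;>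
  · have := hrow i; have := hν i; have := hκ i; have := hν (i + 1); have := hκ (i + 1)
    omega

theorem exists_stripReflection_upper {ν κ τ : YoungDiagram} (hν : IsHStrip τ ν)
    (hκ : IsHStrip τ κ) {a : ℕ} (ha : max (ν.rowLen 0) (κ.rowLen 0) ≤ a) :
    ∃ μ, StripReflection ν κ μ τ ∧ μ.rowLen 0 = a ∧ IsHStrip ν μ ∧ IsHStrip κ μ := by
  let row : ℕ → ℕ := fun
    | 0 => a
    | i + 1 => min (ν.rowLen i) (κ.rowLen i) + max (ν.rowLen (i + 1)) (κ.rowLen (i + 1)) -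
        τ.rowLen i
  have bounds : ∀ i, row (i + 1) ≤ min (ν.rowLen i) (κ.rowLen i) ∧
      max (ν.rowLen i) (κ.rowLen i) ≤ row i := by
    intro i
    have := hν i; have := hκ i
    rcases i with _ | i
    · simp only [row]; omega
    · have := hν i; have := hκ i
      simp only [row]; omega
  have hanti : Antitone row := antitone_nat_of_succ_le fun i => by have := bounds i; omega
  obtain ⟨μ, hμ⟩ := exists_rowLen_eq hanti (N := ν.card + 1)
    (by have := rowLen_eq_zero le_rfl (μ := ν); have := bounds ν.card; omega)
  refine ⟨μ, fun i => ?_, congrFun hμ 0, fun i => ?_, fun i => ?_⟩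
  · have := hν i; have := hκ i
    simp only [hμ, row]
    omega
  all_goals
    have := bounds i
    rw [hμ]
    omega

open Classical in
/-- The commutation relation between adding and removing horizontal strips, which is the local form
of the Cauchy identity. -/
theorem card_common_superStrips {ν κ : YoungDiagram} {b M M' : ℕ} (hM : κ.card + b ≤ M)
    (hM' : ν.card ≤ M') :
    {μ ∈ cardLE M | IsHStrip ν μ ∧ IsHStrip κ μ ∧ μ.card = κ.card + b}.card =
      {τ ∈ cardLE M' | IsHStrip τ ν ∧ IsHStrip τ κ ∧ ν.card ≤ τ.card + b}.card := by
  choose! lower hlower using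
    fun μ (h : IsHStrip ν μ ∧ IsHStrip κ μ) => exists_stripReflection_lower h.1 h.2
  refine Finset.card_nbij lower ?_ ?_ ?_
  · intro μ hμ
    simp only [Finset.mem_coe, Finset.mem_filter, mem_cardLE] at hμ ⊢
    obtain ⟨-, hν, hκ, hcard⟩ := hμ
    obtain ⟨hrefl, hν', hκ'⟩ := hlower μ ⟨hν, hκ⟩
    have := hrefl.card_add_card
    have := hν 0; have := hκ 0
    exact ⟨hν'.card_le.trans hM', hν', hκ', by omega⟩
  · intro μ hμ μ' hμ' heq
    simp only [Finset.mem_coe, Finset.mem_filter, mem_cardLE] at hμ hμ'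
    obtain ⟨-, hν, hκ, hcard⟩ := hμ
    obtain ⟨-, hν', hκ', hcard'⟩ := hμ'
    exact (hlower μ ⟨hν, hκ⟩).1.eq_left (heq ▸ (hlower μ' ⟨hν', hκ'⟩).1) (hcard.trans hcard'.symm)
  · intro τ hτ
    simp only [Finset.mem_coe, Finset.mem_filter, mem_cardLE] at hτ
    obtain ⟨-, hν, hκ, hcard⟩ := hτ
    obtain ⟨μ, hrefl, hrow, hν', hκ'⟩ := exists_stripReflection_upper hν hκ
      (a := max (ν.rowLen 0) (κ.rowLen 0) + (τ.card + b - ν.card)) (by omega)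
    have := hrefl.card_add_card
    refine ⟨μ, ?_, rowLen_injective (funext fun i => ?_)⟩
    · simp only [Finset.mem_coe, Finset.mem_filter, mem_cardLE]
      exact ⟨by omega, hν', hκ', by omega⟩
    · have := (hlower μ ⟨hν', hκ'⟩).1 i
      have := hrefl i
      omega

end YoungDiagrams

section Kostka

open YoungDiagram SemistandardYoungTableau Finsupp

variable {μ ν : YoungDiagram}

/-- The weight of a semistandard tableau: the multiplicities of its entries. -/
noncomputable def entryWeight (T : SemistandardYoungTableau μ) : ℕ →₀ ℕ :=
  ∑ c ∈ μ.cells, single (T c.1 c.2) 1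

theorem entryWeight_apply (T : SemistandardYoungTableau μ) (v : ℕ) :
    entryWeight T v = {c ∈ μ.cells | T c.1 c.2 = v}.card := by
  classical
  rw [entryWeight, finsetSum_apply, Finset.card_filter]
  exact Finset.sum_congr rfl fun c _ => single_apply

theorem degree_entryWeight (T : SemistandardYoungTableau μ) :
    (entryWeight T).degree = μ.card := by
  simp [entryWeight, map_sum, degree_single]

theorem entryWeight_entry_ne_zero (T : SemistandardYoungTableau μ) {i j : ℕ} (h : (i, j) ∈ μ) :
    entryWeight T (T i j) ≠ 0 := by
  rw [entryWeight_apply, Finset.card_ne_zero]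
  exact ⟨(i, j), Finset.mem_filter.2 ⟨h, rfl⟩⟩

instance finite_entryWeight_eq (μ : YoungDiagram) (f : ℕ →₀ ℕ) :
    Finite {T : SemistandardYoungTableau μ // entryWeight T = f} := by
  let entries (T : {T : SemistandardYoungTableau μ // entryWeight T = f}) (c : μ.cells) :
      f.support :=
    ⟨T.1 c.1.1 c.1.2, by
      have := entryWeight_entry_ne_zero T.1 c.2
      rwa [T.2, ← Finsupp.mem_support_iff] at this⟩
  refine Finite.of_injective entries fun T T' h =>
    Subtype.ext (SemistandardYoungTableau.ext fun i j => ?_)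
  by_cases hc : (i, j) ∈ μ
  · exact congrArg Subtype.val (congrFun h ⟨(i, j), hc⟩)
  · rw [T.1.zeros hc, T'.1.zeros hc]

/-- The Kostka number: the number of semistandard tableaux of shape `μ` and weight `f`, which is
the coefficient of `x^f` in the Schur function `s_μ`. -/
noncomputable def kostka (μ : YoungDiagram) (f : ℕ →₀ ℕ) : ℕ :=
  Nat.card {T : SemistandardYoungTableau μ // entryWeight T = f}

theorem card_eq_of_kostka_ne_zero {f : ℕ →₀ ℕ} (h : kostka μ f ≠ 0) : μ.card = f.degree := by
  obtain ⟨T, rfl⟩ := (Nat.card_ne_zero.1 h).1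
  exact (degree_entryWeight T).symm

theorem kostka_eq_zero_of_card_ne {f : ℕ →₀ ℕ} (h : μ.card ≠ f.degree) : kostka μ f = 0 :=
  of_not_not (mt card_eq_of_kostka_ne_zero h)

theorem eq_bot_of_card_eq_zero (h : μ.card = 0) : μ = ⊥ :=
  YoungDiagram.ext (Finset.card_eq_zero.1 h)

theorem kostka_zero_of_ne_bot (h : μ ≠ ⊥) : kostka μ 0 = 0 :=
  kostka_eq_zero_of_card_ne fun hcard => h (eq_bot_of_card_eq_zero (by simpa using hcard))

theorem kostka_bot_zero : kostka ⊥ 0 = 1 := by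
  have : Unique {T : SemistandardYoungTableau ⊥ // entryWeight T = 0} :=
    { default := ⟨highestWeight ⊥, by simp [entryWeight]⟩
      uniq := fun T => Subtype.ext (SemistandardYoungTableau.ext fun i j => by
        rw [T.1.zeros (notMem_bot _), zeros _ (notMem_bot _)]) }
  exact Nat.card_unique

/-- The shape formed by the cells of a semistandard tableau whose entries are smaller than `N`. -/
noncomputable def shapeBelow (T : SemistandardYoungTableau μ) (N : ℕ) : YoungDiagram where
  cells := {c ∈ μ.cells | T c.1 c.2 < N}
  isLowerSet := by
    rintro ⟨a, b⟩ ⟨a', b'⟩ ⟨hrow, hcol⟩ h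
    simp only [Finset.coe_filter, Set.mem_ofPred_eq, mem_cells] at h hrow hcol ⊢
    exact ⟨μ.up_left_mem hrow hcol h.1,
      ((T.row_weak_of_le hcol (μ.up_left_mem hrow le_rfl h.1)).trans
        (T.col_weak hrow h.1)).trans_lt h.2⟩

theorem mem_shapeBelow {T : SemistandardYoungTableau μ} {N i j : ℕ} :
    (i, j) ∈ shapeBelow T N ↔ (i, j) ∈ μ ∧ T i j < N :=
  Finset.mem_filter

theorem shapeBelow_le (T : SemistandardYoungTableau μ) (N : ℕ) : shapeBelow T N ≤ μ :=
  fun _ hc => (mem_shapeBelow.1 hc).1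

theorem isHStrip_shapeBelow {T : SemistandardYoungTableau μ} {N : ℕ}
    (hN : ∀ i j, (i, j) ∈ μ → T i j ≤ N) : IsHStrip (shapeBelow T N) μ := by
  refine fun i => ⟨le_of_forall_lt fun j hj => ?_, le_of_forall_lt fun j hj => ?_⟩ <;>
    rw [← mem_iff_lt_rowLen] at hj ⊢
  · exact mem_shapeBelow.2 ⟨μ.up_left_mem i.le_succ le_rfl hj,
      (T.col_strict i.lt_succ_self hj).trans_le (hN _ _ hj)⟩
  · exact (mem_shapeBelow.1 hj).1

open Classical in
/-- The restriction of a semistandard tableau to a smaller shape. -/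
noncomputable def restrictTo (T : SemistandardYoungTableau μ) (h : ν ≤ μ) :
    SemistandardYoungTableau ν where
  entry i j := if (i, j) ∈ ν then T i j else 0
  row_weak' := by
    intro i j₁ j₂ hj hc
    rw [if_pos hc, if_pos (ν.up_left_mem le_rfl hj.le hc)]
    exact T.row_weak hj (h hc)
  col_strict' := by
    intro i₁ i₂ j hi hc
    rw [if_pos hc, if_pos (ν.up_left_mem hi.le le_rfl hc)]
    exact T.col_strict hi (h hc)
  zeros' := fun h => if_neg h

open Classical in
/-- The extension of a semistandard tableau with entries smaller than `N` by a horizontal strip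
whose cells all get the entry `N`. -/
noncomputable def extendBy (T : SemistandardYoungTableau ν) {N : ℕ}
    (hT : ∀ i j, (i, j) ∈ ν → T i j < N) (h : IsHStrip ν μ) : SemistandardYoungTableau μ where
  entry i j := if (i, j) ∈ ν then T i j else if (i, j) ∈ μ then N else 0
  row_weak' := by
    intro i j₁ j₂ hj hc
    by_cases h₂ : (i, j₂) ∈ ν
    · rw [if_pos h₂, if_pos (ν.up_left_mem le_rfl hj.le h₂)]
      exact T.row_weak hj h₂
    · rw [if_neg h₂, if_pos hc, if_pos (μ.up_left_mem le_rfl hj.le hc)]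
      split_ifs with h₁
      · exact (hT _ _ h₁).le
      · exact le_rfl
  col_strict' := by
    intro i₁ i₂ j hi hc
    have h₁ := h.mem_of_lt hi hc
    rw [if_pos h₁]
    by_cases h₂ : (i₂, j) ∈ ν
    · rw [if_pos h₂]
      exact T.col_strict hi h₂
    · rw [if_neg h₂, if_pos hc]
      exact hT _ _ h₁
  zeros' := by
    intro i j hc
    rw [if_neg fun hν => hc (h.le hν), if_neg hc]

theorem restrictTo_apply (T : SemistandardYoungTableau μ) (h : ν ≤ μ) {i j : ℕ}
    (hc : (i, j) ∈ ν) : restrictTo T h i j = T i j :=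
  if_pos hc

section ExtendBy

variable {T : SemistandardYoungTableau ν} {N : ℕ} {hT : ∀ i j, (i, j) ∈ ν → T i j < N}
  {h : IsHStrip ν μ} {i j : ℕ}

theorem extendBy_of_mem (hc : (i, j) ∈ ν) : extendBy T hT h i j = T i j :=
  if_pos hc

theorem extendBy_of_notMem (hν : (i, j) ∉ ν) (hμ : (i, j) ∈ μ) : extendBy T hT h i j = N :=
  (if_neg hν).trans (if_pos hμ)

theorem restrictTo_extendBy : restrictTo (extendBy T hT h) h.le = T := by
  ext i j
  by_cases hc : (i, j) ∈ ν
  · rw [restrictTo_apply _ _ hc, extendBy_of_mem hc]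
  · rw [zeros _ hc, T.zeros hc]

theorem shapeBelow_extendBy : shapeBelow (extendBy T hT h) N = ν := by
  ext ⟨i, j⟩
  rw [mem_cells, mem_cells, mem_shapeBelow]
  by_cases hc : (i, j) ∈ ν
  · simp [hc, h.le hc, extendBy_of_mem, hT i j hc]
  · simp +contextual [hc, extendBy_of_notMem]

theorem entryWeight_extendBy :
    entryWeight (extendBy T hT h) = single N (μ.card - ν.card) + entryWeight T := by
  have hsub : ν.cells ⊆ μ.cells := cells_subset_iff.2 h.le
  rw [entryWeight, entryWeight, ← Finset.sum_sdiff hsub, YoungDiagram.card, YoungDiagram.card,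
    ← Finset.card_sdiff_of_subset hsub]
  congr 1
  · have hentry : ∀ c ∈ μ.cells \ ν.cells, extendBy T hT h c.1 c.2 = N := fun c hc => by
      rw [Finset.mem_sdiff, mem_cells, mem_cells] at hc
      exact extendBy_of_notMem hc.2 hc.1
    rw [Finset.sum_congr rfl fun c hc => congrArg (single · 1) (hentry c hc), Finset.sum_const,
      smul_single, smul_eq_mul, mul_one]
  · refine Finset.sum_congr rfl fun c hc => ?_
    rw [extendBy_of_mem ((mem_cells c).1 hc)]

end ExtendBy

theorem extendBy_restrictTo_shapeBelow {T : SemistandardYoungTableau μ} {N : ℕ}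
    (hN : ∀ i j, (i, j) ∈ μ → T i j ≤ N) :
    extendBy (restrictTo T (shapeBelow_le T N)) (N := N)
      (fun _ _ hc => (restrictTo_apply T _ hc).trans_lt (mem_shapeBelow.1 hc).2)
      (isHStrip_shapeBelow hN) = T := by
  ext i j
  by_cases hc : (i, j) ∈ shapeBelow T N
  · rw [extendBy_of_mem hc, restrictTo_apply _ _ hc]
  by_cases hμ : (i, j) ∈ μ
  · rw [extendBy_of_notMem hc hμ]
    exact le_antisymm (not_lt.1 fun hlt => hc (mem_shapeBelow.2 ⟨hμ, hlt⟩)) (hN i j hμ)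
  · rw [zeros _ hμ, T.zeros hμ]

theorem entryWeight_eq_single_add {T : SemistandardYoungTableau μ} {N : ℕ}
    (hN : ∀ i j, (i, j) ∈ μ → T i j ≤ N) :
    entryWeight T = single N (μ.card - (shapeBelow T N).card) +
      entryWeight (restrictTo T (shapeBelow_le T N)) := by
  conv_lhs => rw [← extendBy_restrictTo_shapeBelow hN, entryWeight_extendBy]

section Recursion

variable {f : ℕ →₀ ℕ} {N : ℕ}

theorem entry_le_of_entryWeight_eq (hf : ∀ v ∈ f.support, v < N) {b : ℕ}
    {T : SemistandardYoungTableau μ} (hT : entryWeight T = single N b + f) (i j : ℕ)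
    (hc : (i, j) ∈ μ) : T i j ≤ N := by
  by_contra hlt
  have hne := entryWeight_entry_ne_zero T hc
  rw [hT, Finsupp.add_apply, single_eq_of_ne (by omega), zero_add] at hne
  exact hlt (hf _ (Finsupp.mem_support_iff.2 hne)).le

theorem entry_lt_of_entryWeight_eq (hf : ∀ v ∈ f.support, v < N)
    {T : SemistandardYoungTableau ν} (hT : entryWeight T = f) (i j : ℕ) (hc : (i, j) ∈ ν) :
    T i j < N :=
  hf _ (Finsupp.mem_support_iff.2 (hT ▸ entryWeight_entry_ne_zero T hc))

theorem card_eq_of_entryWeight_eq (hf : ∀ v ∈ f.support, v < N) {b : ℕ}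
    {T : SemistandardYoungTableau μ} (hT : entryWeight T = single N b + f) :
    μ.card = (shapeBelow T N).card + b := by
  have hle := card_mono (shapeBelow_le T N)
  have hweight := entryWeight_eq_single_add (entry_le_of_entryWeight_eq hf hT)
  have hN : entryWeight (restrictTo T (shapeBelow_le T N)) N = 0 := by
    rw [entryWeight_apply, Finset.card_eq_zero, Finset.filter_eq_empty_iff]
    intro c hc
    rw [restrictTo_apply _ _ ((mem_cells c).1 hc)]
    exact (mem_shapeBelow.1 hc).2.ne
  have hfN : f N = 0 := Finsupp.notMem_support_iff.1 fun h => (hf N h).false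
  have := DFunLike.congr_fun (hT.symm.trans hweight) N
  simp only [Finsupp.add_apply, single_eq_same, hfN, hN] at this
  omega

theorem card_shapeBelow_eq_kostka (hf : ∀ v ∈ f.support, v < N) {b : ℕ} (h : IsHStrip ν μ)
    (hcard : μ.card = ν.card + b) :
    Nat.card {T : SemistandardYoungTableau μ //
      entryWeight T = single N b + f ∧ shapeBelow T N = ν} = kostka ν f := by
  refine Nat.card_congr
    { toFun := fun T => ⟨restrictTo T.1 h.le, ?_⟩
      invFun := fun T => ⟨extendBy T.1 (entry_lt_of_entryWeight_eq hf T.2) h, ?_,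
        shapeBelow_extendBy⟩
      left_inv := ?_
      right_inv := fun T => Subtype.ext
        (restrictTo_extendBy (hT := entry_lt_of_entryWeight_eq hf T.2) (h := h)) }
  · obtain ⟨T, hT, rfl⟩ := T
    have hweight := entryWeight_eq_single_add (entry_le_of_entryWeight_eq hf hT)
    rw [hT, hcard, Nat.add_sub_cancel_left] at hweight
    exact (add_left_cancel hweight).symm
  · rw [entryWeight_extendBy, T.2, hcard, Nat.add_sub_cancel_left]
  · rintro ⟨T, hT, rfl⟩
    exact Subtype.ext (extendBy_restrictTo_shapeBelow (entry_le_of_entryWeight_eq hf hT))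

open Classical in
theorem kostka_single_add (hf : ∀ v ∈ f.support, v < N) (b : ℕ) {M : ℕ} (hM : μ.card ≤ M) :
    kostka μ (single N b + f) =
      ∑ ν ∈ cardLE M with IsHStrip ν μ ∧ μ.card = ν.card + b, kostka ν f := by
  let _ := Fintype.ofFinite {T : SemistandardYoungTableau μ // entryWeight T = single N b + f}
  rw [kostka, Nat.card_eq_fintype_card, ← Finset.card_univ,
    Finset.card_eq_sum_card_fiberwise (f := fun T => shapeBelow T.1 N)
      (t := {ν ∈ cardLE M | IsHStrip ν μ ∧ μ.card = ν.card + b})]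
  · refine Finset.sum_congr rfl fun ν hν => ?_
    obtain ⟨-, hstrip, hcard⟩ := Finset.mem_filter.1 hν
    rw [← card_shapeBelow_eq_kostka hf hstrip hcard, ← Fintype.card_subtype,
      ← Nat.card_eq_fintype_card]
    exact Nat.card_congr (Equiv.subtypeSubtypeEquivSubtypeInter
      (fun T : SemistandardYoungTableau μ => entryWeight T = single N b + f)
      (fun T => shapeBelow T N = ν))
  · rintro ⟨T, hT⟩ -
    have hstrip := isHStrip_shapeBelow (entry_le_of_entryWeight_eq hf hT)
    exact Finset.mem_coe.2 (Finset.mem_filter.2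
      ⟨mem_cardLE.2 (hstrip.card_le.trans hM), hstrip, card_eq_of_entryWeight_eq hf hT⟩)

end Recursion

end Kostka

section SumIic

open Finsupp

variable {ι κ M : Type*} [AddCommMonoid M]

theorem sum_Iic_single_add [DecidableEq ι] {a : ι} {f : ι →₀ ℕ} (hfa : f a = 0) (b : ℕ)
    (F : (ι →₀ ℕ) → M) :
    ∑ h ∈ Finset.Iic (single a b + f), F h =
      ∑ j ∈ Finset.Iic b, ∑ h ∈ Finset.Iic f, F (single a j + h) := by
  rw [← Finset.sum_product']
  refine Finset.sum_nbij' (fun h => (h a, h.erase a)) (fun p => single a p.1 + p.2)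
    (fun h hh => ?_) (fun p hp => ?_) (fun h _ => single_add_erase a h) (fun p hp => ?_)
    (fun h _ => (congrArg F (single_add_erase a h)).symm)
  · rw [Finset.mem_Iic] at hh
    refine Finset.mem_product.2 ⟨Finset.mem_Iic.2 ?_, Finset.mem_Iic.2 fun i => ?_⟩
    · simpa [hfa] using hh a
    · by_cases hi : i = a
      · simp [hi]
      · simpa [Finsupp.erase_ne hi, single_eq_of_ne hi] using hh i
  · obtain ⟨hj, hh⟩ := Finset.mem_product.1 hp
    exact Finset.mem_Iic.2 (add_le_add (single_mono (Finset.mem_Iic.1 hj)) (Finset.mem_Iic.1 hh))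
  · have hpa : p.2 a = 0 :=
      Nat.le_zero.1 (hfa ▸ Finset.mem_Iic.1 (Finset.mem_product.1 hp).2 a)
    refine Prod.ext (by simp [hpa]) ?_
    rw [erase_add, erase_single, zero_add, erase_of_notMem_support (by simpa using hpa)]

theorem sum_Iic_mapDomain [DecidableEq ι] [DecidableEq κ] (e : ι ≃ κ) (f : ι →₀ ℕ)
    (F : (κ →₀ ℕ) → M) :
    ∑ h ∈ Finset.Iic (f.mapDomain e), F h = ∑ h ∈ Finset.Iic f, F (h.mapDomain e) := by
  refine (Finset.sum_nbij' (mapDomain e) (mapDomain e.symm)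
    (fun h hh => ?_) (fun h hh => ?_) (fun h _ => ?_) (fun h _ => ?_) (fun h _ => rfl)).symm
  · exact Finset.mem_Iic.2 (mapDomain_mono (Finset.mem_Iic.1 hh))
  · have := mapDomain_mono (f := e.symm) (Finset.mem_Iic.1 hh)
    rw [← mapDomain_comp, e.symm_comp_self, mapDomain_id] at this
    exact Finset.mem_Iic.2 this
  · rw [← mapDomain_comp, e.symm_comp_self, mapDomain_id]
  · rw [← mapDomain_comp, e.self_comp_symm, mapDomain_id]

end SumIic

section Pieri

open YoungDiagram Finsupp

variable {f : ℕ →₀ ℕ} {a : ℕ}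

open Classical in
theorem sum_kostka_superStrips_single_add (hf : ∀ v ∈ f.support, v < a) (ν : YoungDiagram)
    (b M : ℕ) :
    ∑ μ ∈ cardLE M with IsHStrip ν μ, kostka μ (single a b + f) =
      ∑ κ ∈ cardLE M,
        {μ ∈ cardLE M | IsHStrip ν μ ∧ IsHStrip κ μ ∧ μ.card = κ.card + b}.card * kostka κ f := by
  rw [Finset.sum_congr rfl fun μ hμ =>
    kostka_single_add hf b (mem_cardLE.1 (Finset.mem_filter.1 hμ).1),
    Finset.sum_comm' (t' := cardLE M)
      (s' := fun κ => {μ ∈ cardLE M | IsHStrip ν μ ∧ IsHStrip κ μ ∧ μ.card = κ.card + b})]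
  · exact Finset.sum_congr rfl fun κ _ => by rw [Finset.sum_const, smul_eq_mul]
  · simp only [Finset.mem_filter]
    tauto

open Classical in
theorem sum_kostka_Iic_single_add (hf : ∀ v ∈ f.support, v < a) (ν : YoungDiagram) (b : ℕ)
    {M : ℕ} (pieri : ∀ τ,
      ∑ κ ∈ cardLE M with IsHStrip τ κ, kostka κ f = ∑ h ∈ Finset.Iic f, kostka τ h) :
    ∑ h ∈ Finset.Iic (single a b + f), kostka ν h =
      ∑ κ ∈ cardLE M, {τ ∈ cardLE ν.card | IsHStrip τ ν ∧ IsHStrip τ κ ∧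
        ν.card ≤ τ.card + b}.card * kostka κ f := by
  have hfa : f a = 0 := Finsupp.notMem_support_iff.1 fun h => (hf a h).false
  have hbelow {h : ℕ →₀ ℕ} (hh : h ∈ Finset.Iic f) : ∀ v ∈ h.support, v < a := fun v hv =>
    hf v (support_mono (Finset.mem_Iic.1 hh) hv)
  calc ∑ h ∈ Finset.Iic (single a b + f), kostka ν h
      = ∑ j ∈ Finset.Iic b, ∑ h ∈ Finset.Iic f,
          ∑ τ ∈ cardLE ν.card with IsHStrip τ ν ∧ ν.card = τ.card + j, kostka τ h := by
        rw [sum_Iic_single_add hfa]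
        exact Finset.sum_congr rfl fun j _ => Finset.sum_congr rfl fun h hh =>
          kostka_single_add (hbelow hh) j le_rfl
    _ = ∑ j ∈ Finset.Iic b, ∑ τ ∈ cardLE ν.card with IsHStrip τ ν ∧ ν.card = τ.card + j,
          ∑ κ ∈ cardLE M with IsHStrip τ κ, kostka κ f := by
        refine Finset.sum_congr rfl fun j _ => ?_
        rw [Finset.sum_comm]
        exact Finset.sum_congr rfl fun τ _ => (pieri τ).symm
    _ = ∑ τ ∈ cardLE ν.card with IsHStrip τ ν ∧ ν.card ≤ τ.card + b,
          ∑ κ ∈ cardLE M with IsHStrip τ κ, kostka κ f := by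
        rw [← Finset.sum_fiberwise_of_maps_to (t := Finset.Iic b)
          (g := fun τ : YoungDiagram => ν.card - τ.card)]
        · refine Finset.sum_congr rfl fun j hj => Finset.sum_congr ?_ fun _ _ => rfl
          ext τ
          simp only [Finset.mem_filter, Finset.mem_Iic] at hj ⊢
          constructor
          · rintro ⟨hτ, hstrip, hcard⟩
            exact ⟨⟨hτ, hstrip, by omega⟩, by omega⟩
          · rintro ⟨⟨hτ, hstrip, -⟩, hcard⟩
            have := hstrip.card_le
            exact ⟨hτ, hstrip, by omega⟩
        · intro τ hτ
          simp only [Finset.mem_filter, Finset.mem_Iic] at hτ ⊢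
          omega
    _ = _ := by
        rw [Finset.sum_comm' (t' := cardLE M) (s' := fun κ =>
          {τ ∈ cardLE ν.card | IsHStrip τ ν ∧ IsHStrip τ κ ∧ ν.card ≤ τ.card + b})]
        · exact Finset.sum_congr rfl fun κ _ => by rw [Finset.sum_const, smul_eq_mul]
        · simp only [Finset.mem_filter]
          tauto

open Classical in
theorem sum_kostka_isHStrip (ν : YoungDiagram) (f : ℕ →₀ ℕ) {M : ℕ} (hM : f.degree ≤ M) :
    ∑ μ ∈ cardLE M with IsHStrip ν μ, kostka μ f = ∑ h ∈ Finset.Iic f, kostka ν h := by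
  induction f using Finsupp.induction_on_max generalizing ν with
  | zero =>
    have hIic : Finset.Iic (0 : ℕ →₀ ℕ) = {0} := by
      ext h
      simp
    rw [hIic, Finset.sum_singleton, Finset.sum_filter]
    by_cases hν : ν = ⊥
    · rw [Finset.sum_eq_single (⊥ : YoungDiagram), hν, if_pos (IsHStrip.refl ⊥)]
      · exact fun μ _ hμ => by rw [kostka_zero_of_ne_bot hμ, ite_self]
      · exact fun h => absurd (mem_cardLE.2 M.zero_le) h
    · rw [kostka_zero_of_ne_bot hν]
      refine Finset.sum_eq_zero fun μ _ => ?_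
      by_cases hμ : μ = ⊥
      · exact if_neg fun hstrip => hν (le_bot_iff.1 (hμ ▸ hstrip.le))
      · rw [kostka_zero_of_ne_bot hμ, ite_self]
  | single_add a b f hf _ ih =>
    rw [map_add, degree_single] at hM
    rw [sum_kostka_superStrips_single_add hf,
      sum_kostka_Iic_single_add hf ν b fun τ => ih τ (by omega)]
    refine Finset.sum_congr rfl fun κ _ => ?_
    by_cases hκ : kostka κ f = 0
    · rw [hκ, mul_zero, mul_zero]
    · rw [card_common_superStrips (by rw [card_eq_of_kostka_ne_zero hκ]; omega) le_rfl]

end Pieri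

section Symmetry

open YoungDiagram Finsupp

variable {μ ν κ : YoungDiagram} {N : ℕ}

theorem exists_rowLen_truncation (μ : YoungDiagram) (N : ℕ) :
    ∃ ν : YoungDiagram, (∀ i < N, ν.rowLen i = μ.rowLen i) ∧ ν.rowLen N = 0 := by
  obtain ⟨ν, hν⟩ := exists_rowLen_eq (f := fun i => if i < N then μ.rowLen i else 0) (N := N)
    (fun i j hij => by
      dsimp only
      split_ifs
      · exact μ.rowLen_anti i j hij
      · omega
      · exact Nat.zero_le _
      · exact le_rfl)
    (if_neg (lt_irrefl N))
  exact ⟨ν, fun i hi => (congrFun hν i).trans (if_pos hi),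
    (congrFun hν N).trans (if_neg (lt_irrefl N))⟩

theorem rowLen_lt_of_isHStrip (hνμ : ∀ i < N, ν.rowLen i = μ.rowLen i) (hν : ν.rowLen N = 0)
    (hμ : μ.rowLen (N + 1) = 0) (hstrip : IsHStrip ν κ) (hcard : κ.card = μ.card) (hne : κ ≠ μ) :
    κ.rowLen (N + 1) = 0 ∧ κ.rowLen N < μ.rowLen N := by
  have hκ : κ.rowLen (N + 1) = 0 := Nat.le_zero.1 ((hstrip N).1.trans_eq hν)
  refine ⟨hκ, lt_of_not_ge fun hge => hne (rowLen_injective (funext fun i => ?_))⟩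
  have hle : ∀ i ∈ Finset.range (N + 1), μ.rowLen i ≤ κ.rowLen i := fun i hi => by
    obtain hi | rfl := (Finset.mem_range_succ_iff.1 hi).lt_or_eq
    · exact hνμ i hi ▸ (hstrip i).2
    · exact hge
  rw [card_eq_sum_rowLen hκ, card_eq_sum_rowLen hμ, eq_comm, Finset.sum_eq_sum_iff_of_le hle]
    at hcard
  by_cases hi : i < N + 1
  · exact (hcard i (Finset.mem_range.2 hi)).symm
  · rw [rowLen_eq_zero_of_le hκ (not_lt.1 hi), rowLen_eq_zero_of_le hμ (not_lt.1 hi)]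

theorem isHStrip_of_truncation (hνμ : ∀ i < N, ν.rowLen i = μ.rowLen i) (hν : ν.rowLen N = 0)
    (hμ : μ.rowLen (N + 1) = 0) : IsHStrip ν μ := by
  intro i
  obtain hi | hi := lt_or_ge i N
  · rw [hνμ i hi]
    exact IsHStrip.refl μ i
  · rw [rowLen_eq_zero_of_le hν hi, rowLen_eq_zero_of_le hμ (Nat.succ_le_succ hi)]
    exact ⟨le_rfl, Nat.zero_le _⟩

theorem kostka_mapDomain_of_isHStrip (hstrip : IsHStrip ν μ) {f : ℕ →₀ ℕ} {g : Equiv.Perm ℕ}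
    (hν : ∀ h, kostka ν (h.mapDomain g) = kostka ν h)
    (hother : ∀ κ, IsHStrip ν κ → κ.card = μ.card → κ ≠ μ →
      kostka κ (f.mapDomain g) = kostka κ f) :
    kostka μ (f.mapDomain g) = kostka μ f := by
  classical
  have hdegree : (f.mapDomain g).degree = f.degree := degree_mapDomain g f
  by_cases hcard : μ.card = f.degree
  · have pieri := sum_kostka_isHStrip ν f le_rfl
    have pieri' := sum_kostka_isHStrip ν (f.mapDomain g) hdegree.le
    have hμ : μ ∈ {κ ∈ cardLE f.degree | IsHStrip ν κ} :=
      Finset.mem_filter.2 ⟨mem_cardLE.2 hcard.le, hstrip⟩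
    rw [sum_Iic_mapDomain g, Finset.sum_congr rfl fun h _ => hν h, ← pieri,
      ← Finset.add_sum_erase _ _ hμ, ← Finset.add_sum_erase _ _ hμ] at pieri'
    refine Nat.add_right_cancel (pieri'.trans (congrArg _ (Finset.sum_congr rfl fun κ hκ => ?_)))
    obtain ⟨hne, hκ⟩ := Finset.mem_erase.1 hκ
    by_cases hcard' : κ.card = μ.card
    · exact (hother κ (Finset.mem_filter.1 hκ).2 hcard' hne).symm
    · rw [hcard] at hcard'
      rw [kostka_eq_zero_of_card_ne hcard', kostka_eq_zero_of_card_ne (hdegree ▸ hcard')]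
  · rw [kostka_eq_zero_of_card_ne hcard, kostka_eq_zero_of_card_ne (hdegree ▸ hcard)]

-- For a shape `ν` obtained by deleting the last row of `μ`, Pieri's rule writes `kostka μ` as a
-- symmetric function minus Kostka numbers of shapes whose last row is shorter than that of `μ`.
theorem kostka_mapDomain_of_rowLen_eq_zero (N : ℕ) (hμ : μ.rowLen N = 0) (f : ℕ →₀ ℕ)
    (g : Equiv.Perm ℕ) : kostka μ (f.mapDomain g) = kostka μ f := by
  induction N generalizing μ f with
  | zero =>
    have hcard : μ.card = 0 := by rw [card_eq_sum_rowLen hμ, Finset.sum_range_zero]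
    by_cases hf : f = 0
    · rw [hf, mapDomain_zero]
    · have hdegree : f.degree ≠ 0 := mt (degree_eq_zero_iff f).1 hf
      rw [kostka_eq_zero_of_card_ne (by rw [degree_mapDomain]; omega),
        kostka_eq_zero_of_card_ne (by omega)]
  | succ N ih =>
    induction hlast : μ.rowLen N using Nat.strong_induction_on generalizing μ with
    | _ l ih_last =>
      obtain ⟨ν, hνμ, hν⟩ := exists_rowLen_truncation μ N
      refine kostka_mapDomain_of_isHStrip (isHStrip_of_truncation hνμ hν hμ)
        (fun h => ih hν h) fun κ hstrip hcard hne => ?_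
      obtain ⟨hκ, hlt⟩ := rowLen_lt_of_isHStrip hνμ hν hμ hstrip hcard hne
      exact ih_last _ (hlast ▸ hlt) hκ rfl

theorem kostka_mapDomain (μ : YoungDiagram) (f : ℕ →₀ ℕ) (g : Equiv.Perm ℕ) :
    kostka μ (f.mapDomain g) = kostka μ f :=
  kostka_mapDomain_of_rowLen_eq_zero μ.card (rowLen_eq_zero le_rfl) f g

end Symmetry

section MultiSchur

open YoungDiagram SemistandardYoungTableau Finsupp

variable {r : ℕ} {lam nu : Fin r → YoungDiagram} {m : VarIndex r →₀ ℕ}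

theorem ext_curry {m m' : VarIndex r →₀ ℕ} (h : ∀ i, m.curry i = m'.curry i) : m = m' :=
  curryEquiv.injective (Finsupp.ext h)

theorem degree_eq_sum_degree_curry (m : VarIndex r →₀ ℕ) :
    m.degree = ∑ i, (m.curry i).degree := by
  have h := sum_curry_index m (fun _ _ n => n)
  rw [m.curry.sum_fintype _ fun _ => sum_zero_index] at h
  exact h.symm

theorem sum_Iic_prod_curry (m : VarIndex r →₀ ℕ) (F : Fin r → (ℕ →₀ ℕ) → ℕ) :
    ∑ h ∈ Finset.Iic m, ∏ i, F i (h.curry i) = ∏ i, ∑ h ∈ Finset.Iic (m.curry i), F i h := by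
  rw [Finset.prod_univ_sum]
  refine Finset.sum_nbij' (fun h i => h.curry i)
    (fun p => (equivFunOnFinite.symm p).uncurry) (fun h hh => ?_) (fun p hp => ?_)
    (fun h _ => ?_) (fun p _ => ?_) fun _ _ => rfl
  · exact Fintype.mem_piFinset.2 fun i => Finset.mem_Iic.2 fun v => Finset.mem_Iic.1 hh (i, v)
  · exact Finset.mem_Iic.2 fun x => Finset.mem_Iic.1 (Fintype.mem_piFinset.1 hp x.1) x.2
  · exact ext_curry fun i => DFunLike.congr_fun (curry_uncurry _) i
  · exact funext fun i => DFunLike.congr_fun (curry_uncurry _) i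

theorem curry_mapDomain (g : Fin r → Equiv.Perm ℕ) (m : VarIndex r →₀ ℕ) (i : Fin r) :
    (m.mapDomain fun p => (p.1, g p.1 p.2)).curry i = (m.curry i).mapDomain (g i) := by
  have hinj : Function.Injective fun p : VarIndex r => (p.1, g p.1 p.2) := by
    rintro ⟨a, b⟩ ⟨a', b'⟩ h
    obtain rfl : a = a' := congrArg Prod.fst h
    exact Prod.ext rfl ((g a).injective (congrArg Prod.snd h))
  ext v
  obtain ⟨u, rfl⟩ := (g i).surjective v
  rw [mapDomain_apply (g i).injective]
  exact mapDomain_apply hinj m (i, u)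

theorem curry_tableauWeight (T : ∀ i, SemistandardYoungTableau (lam i)) (i : Fin r) :
    (tableauWeight T).curry i = entryWeight (T i) := by
  classical
  ext v
  rw [curry_apply, tableauWeight, entryWeight, finsetSum_apply, finsetSum_apply,
    Finset.sum_eq_single i _ fun h => absurd (Finset.mem_univ i) h]
  · simp [finsetSum_apply, single_apply]
  · intro j _ hj
    simp [finsetSum_apply, hj]

theorem tableauWeight_eq_iff {T : ∀ i, SemistandardYoungTableau (lam i)} :
    tableauWeight T = m ↔ ∀ i, entryWeight (T i) = m.curry i := by
  refine ⟨?_, fun h => ext_curry fun i => (curry_tableauWeight T i).trans (h i)⟩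
  rintro rfl i
  exact (curry_tableauWeight T i).symm

/-- The coefficient of `x^m` in the Schur function `s_λ` of an `r`-partition `λ`, as a natural
number. -/
noncomputable def schurCount (lam : Fin r → YoungDiagram) (m : VarIndex r →₀ ℕ) : ℕ :=
  ∏ i, kostka (lam i) (m.curry i)

theorem coeff_schur (lam : Fin r → YoungDiagram) (m : VarIndex r →₀ ℕ) :
    MvPowerSeries.coeff m (schur lam) = schurCount lam m := by
  change ((Nat.card _ : ℕ) : ℚ) = _
  rw [schurCount]
  simp only [kostka]
  rw [← Nat.card_pi]
  exact congrArg Nat.cast <| Nat.card_congr <|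
    (Equiv.subtypeEquivRight fun T => tableauWeight_eq_iff).trans
      (Equiv.subtypePiEquivPi (p := fun i (T : SemistandardYoungTableau (lam i)) =>
        entryWeight T = m.curry i))

theorem sum_card_eq_of_schurCount_ne_zero (h : schurCount lam m ≠ 0) :
    ∑ i, (lam i).card = m.degree := by
  rw [degree_eq_sum_degree_curry]
  exact Finset.sum_congr rfl fun i hi =>
    card_eq_of_kostka_ne_zero (Finset.prod_ne_zero_iff.1 h i hi)

open Classical in
theorem sum_schurCount_isHStrip (nu : Fin r → YoungDiagram) {M : ℕ} (hM : m.degree ≤ M) :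
    ∑ lam ∈ Fintype.piFinset (fun _ : Fin r => cardLE M) with ∀ i, IsHStrip (nu i) (lam i),
      schurCount lam m = ∑ h ∈ Finset.Iic m, schurCount nu h := by
  have hdegree (i : Fin r) : (m.curry i).degree ≤ M :=
    (Finset.single_le_sum (f := fun i => (m.curry i).degree) (fun _ _ => Nat.zero_le _)
      (Finset.mem_univ i)).trans ((degree_eq_sum_degree_curry m).ge.trans hM)
  simp only [schurCount]
  rw [sum_Iic_prod_curry m fun i => kostka (nu i),
    ← Finset.prod_congr rfl fun i _ => sum_kostka_isHStrip (nu i) (m.curry i) (hdegree i),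
    Finset.prod_univ_sum]
  refine Finset.sum_congr ?_ fun _ _ => rfl
  ext lam
  simp only [Finset.mem_filter, Fintype.mem_piFinset, forall_and]

theorem schur_mem_SymmR (lam : Fin r → YoungDiagram) : schur lam ∈ SymmR r := by
  refine ⟨⟨∑ i, (lam i).card, fun m h => ?_⟩, fun g m => ?_⟩
  · rw [coeff_schur, Nat.cast_ne_zero] at h
    exact (sum_card_eq_of_schurCount_ne_zero h).ge
  · rw [coeff_schur, coeff_schur, schurCount, schurCount]
    exact congrArg Nat.cast <| Finset.prod_congr rfl fun i _ => by
      rw [curry_mapDomain, kostka_mapDomain]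

end MultiSchur

section Omega

open YoungDiagram SemistandardYoungTableau Finsupp

variable {μ ν : YoungDiagram} {r : ℕ} {lam nu : Fin r → YoungDiagram}

/-- The sum of the row indices of the cells of a Young diagram, often written `n(μ)`; it is the
smallest sum of entries of a semistandard tableau of shape `μ`. -/
def rowIndexSum (μ : YoungDiagram) : ℕ := ∑ c ∈ μ.cells, c.1

theorem row_le_entry (T : SemistandardYoungTableau μ) {i j : ℕ} (h : (i, j) ∈ μ) : i ≤ T i j := by
  induction i with
  | zero => exact Nat.zero_le _
  | succ i ih =>
    exact (ih (μ.up_left_mem i.le_succ le_rfl h)).trans_lt (T.col_strict i.lt_succ_self h)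

theorem sum_entries_eq (T : SemistandardYoungTableau μ) :
    ∑ c ∈ μ.cells, T c.1 c.2 = linearCombination ℕ id (entryWeight T) := by
  simp [entryWeight, map_sum]

theorem entryWeight_eq_rowLen {T : SemistandardYoungTableau μ}
    (h : ∀ c ∈ μ.cells, c.1 = T c.1 c.2) (v : ℕ) : entryWeight T v = μ.rowLen v := by
  rw [entryWeight_apply, rowLen_eq_card]
  exact congrArg Finset.card (Finset.filter_congr fun c hc => by rw [← h c hc])

theorem highestWeight_entry (ν : YoungDiagram) :
    ∀ c ∈ ν.cells, c.1 = highestWeight ν c.1 c.2 := fun c hc => by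
  rw [highestWeight_apply, if_pos ((mem_cells c).1 hc)]

/-- The largest weight of a semistandard tableau of shape `ν` in the dominance order; its entries
are the row lengths of `ν`. -/
noncomputable def topWeight (ν : YoungDiagram) : ℕ →₀ ℕ := entryWeight (highestWeight ν)

theorem kostka_topWeight_self_ne_zero (ν : YoungDiagram) : kostka ν (topWeight ν) ≠ 0 :=
  Nat.card_ne_zero.2 ⟨⟨highestWeight ν, rfl⟩, inferInstance⟩

theorem rowIndexSum_le_of_kostka_topWeight_ne_zero (h : kostka μ (topWeight ν) ≠ 0) :
    rowIndexSum μ ≤ rowIndexSum ν ∧ (rowIndexSum μ = rowIndexSum ν → μ = ν) := by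
  obtain ⟨T, hT⟩ := (Nat.card_ne_zero.1 h).1
  have hentries : ∑ c ∈ μ.cells, T c.1 c.2 = rowIndexSum ν := by
    rw [sum_entries_eq, hT, topWeight, ← sum_entries_eq]
    exact (Finset.sum_congr rfl (highestWeight_entry ν)).symm
  have hle : ∀ c ∈ μ.cells, c.1 ≤ T c.1 c.2 := fun c hc => row_le_entry T hc
  refine ⟨hentries ▸ Finset.sum_le_sum hle, fun heq => rowLen_injective (funext fun v => ?_)⟩
  have hentry := (Finset.sum_eq_sum_iff_of_le hle).1 (heq.trans hentries.symm)
  rw [← entryWeight_eq_rowLen hentry, hT, topWeight, entryWeight_eq_rowLen (highestWeight_entry ν)]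

theorem exists_schurCount_triangular (nu : Fin r → YoungDiagram) :
    ∃ m : VarIndex r →₀ ℕ, schurCount nu m ≠ 0 ∧ ∀ lam, lam ≠ nu → schurCount lam m ≠ 0 →
      ∑ i, rowIndexSum (lam i) < ∑ i, rowIndexSum (nu i) := by
  have hcurry (i : Fin r) :
      (tableauWeight fun i => highestWeight (nu i)).curry i = topWeight (nu i) :=
    curry_tableauWeight _ i
  refine ⟨tableauWeight fun i => highestWeight (nu i), ?_, fun lam hne h => ?_⟩
  · simp only [schurCount, hcurry]
    exact Finset.prod_ne_zero_iff.2 fun i _ => kostka_topWeight_self_ne_zero (nu i)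
  · simp only [schurCount, hcurry] at h
    have hle (i : Fin r) := rowIndexSum_le_of_kostka_topWeight_ne_zero
      (Finset.prod_ne_zero_iff.1 h i (Finset.mem_univ i))
    obtain ⟨i, hi⟩ := Function.ne_iff.1 hne
    exact Finset.sum_lt_sum (fun i _ => (hle i).1)
      ⟨i, Finset.mem_univ i, (hle i).1.lt_of_ne (mt (hle i).2 hi)⟩

theorem linearIndependent_schur (r : ℕ) : LinearIndependent ℚ
    (schur : (Fin r → YoungDiagram) → MvPowerSeries (VarIndex r) ℚ) := by
  rw [linearIndependent_iff]
  intro l hl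
  by_contra hne
  obtain ⟨nu, hnu, hmin⟩ := l.support.exists_min_image (fun lam => ∑ i, rowIndexSum (lam i))
    (support_nonempty_iff.2 hne)
  obtain ⟨m, hm, hlt⟩ := exists_schurCount_triangular nu
  have hcoeff := congrArg (MvPowerSeries.coeff m) hl
  rw [linearCombination_apply, Finsupp.sum, map_sum, map_zero, Finset.sum_eq_single nu,
    map_smul, coeff_schur, smul_eq_mul] at hcoeff
  · exact mul_ne_zero (Finsupp.mem_support_iff.1 hnu) (Nat.cast_ne_zero.2 hm) hcoeff
  · intro lam hlam hne
    have hzero : schurCount lam m = 0 :=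
      of_not_not fun h => (hmin lam hlam).not_gt (hlt lam hne h)
    rw [map_smul, coeff_schur, hzero, Nat.cast_zero, smul_zero]
  · exact fun h => absurd hnu h

theorem exists_isOmega (r : ℕ) : ∃ w, IsOmega r w := by
  let s : (Fin r → YoungDiagram) → SymmR r := fun lam => ⟨schur lam, schur_mem_SymmR lam⟩
  have hs : LinearIndependent ℚ s :=
    LinearIndependent.of_comp (SymmR r).subtype (linearIndependent_schur r)
  obtain ⟨w, hw⟩ := LinearMap.exists_extend
    ((linearCombination ℚ fun lam => s (conj lam)).comp hs.repr)
  refine ⟨w, fun lam => ⟨schur_mem_SymmR lam, congrArg Subtype.val (?_ : w (s lam) = s (conj lam))⟩⟩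
  calc w (s lam) = linearCombination ℚ (fun lam => s (conj lam))
        (hs.repr ⟨s lam, Submodule.subset_span ⟨lam, rfl⟩⟩) :=
        LinearMap.congr_fun hw ⟨s lam, Submodule.subset_span ⟨lam, rfl⟩⟩
    _ = s (conj lam) := by
      rw [hs.repr_eq_single lam _ rfl, linearCombination_single, one_smul]

theorem isOmega_omega (r : ℕ) : IsOmega r (omega r) := by
  rw [omega, dif_pos (exists_isOmega r)]
  exact (exists_isOmega r).choose_spec

theorem omegaSeries_sum_smul_schur {ι : Type*} (s : Finset ι) (c : ι → ℚ)
    (lam : ι → Fin r → YoungDiagram) :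
    omegaSeries r (∑ t ∈ s, c t • schur (lam t)) = ∑ t ∈ s, c t • schur (conj (lam t)) := by
  have hsum : ∑ t ∈ s, c t • schur (lam t) =
      (∑ t ∈ s, c t • (⟨schur (lam t), schur_mem_SymmR (lam t)⟩ : SymmR r) : SymmR r) := by
    simp only [AddSubmonoidClass.coe_finsetSum, Submodule.coe_smul]
  rw [hsum, omegaSeries, dif_pos (Subtype.prop _), Subtype.coe_eta, map_sum,
    AddSubmonoidClass.coe_finsetSum]
  refine Finset.sum_congr rfl fun t _ => ?_
  obtain ⟨h, hw⟩ := isOmega_omega r (lam t)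
  rw [map_smul, Submodule.coe_smul, hw]

end Omega

section Descents

variable {α : Type*} [LinearOrder α]

/-- The descent set of a word over a linearly ordered alphabet, positions counted from `1`. -/
def descentSet (w : List α) : Finset ℕ :=
  {i ∈ Finset.Ico 1 w.length | ∃ _ : i < w.length, w[i] < w[i - 1]}

theorem mem_descentSet {w : List α} {i : ℕ} :
    i ∈ descentSet w ↔ ∃ (_ : 1 ≤ i) (_ : i < w.length), w[i] < w[i - 1] := by
  simp only [descentSet, Finset.mem_filter, Finset.mem_Ico]
  exact ⟨fun ⟨h, hlt⟩ => ⟨h.1, hlt⟩, fun ⟨h, hlt⟩ => ⟨⟨h, hlt.1⟩, hlt⟩⟩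

theorem descentSet_subset_iff {w : List α} {D : Finset ℕ} :
    descentSet w ⊆ D ↔ ∀ (i : ℕ) (h : i + 1 < w.length), i + 1 ∉ D → w[i] ≤ w[i + 1] := by
  constructor
  · intro hs i h hi
    by_contra hc
    exact hi (hs (mem_descentSet.2 ⟨by omega, h, not_le.1 hc⟩))
  · intro hs i hi
    obtain ⟨h1, h2, h3⟩ := mem_descentSet.1 hi
    by_contra hc
    obtain ⟨i, rfl⟩ := Nat.exists_eq_add_of_le' h1
    exact absurd (hs i h2 hc) (not_le.2 h3)

theorem descentSet_append_subset_iff {u v : List α} {D : Finset ℕ}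
    (hp : u.length = 0 ∨ u.length ∈ D)
    (hD : ∀ i, u.length < i → i < u.length + v.length → i ∉ D) :
    descentSet (u ++ v) ⊆ D ↔ descentSet u ⊆ D ∧ v.Pairwise (· ≤ ·) := by
  rw [← List.isChain_iff_pairwise, List.isChain_iff_getElem, descentSet_subset_iff,
    descentSet_subset_iff]
  refine ⟨fun h => ⟨fun i hi hiD => ?_, fun i hi => ?_⟩, ?_⟩
  · have := h i (by rw [List.length_append]; omega) hiD
    rwa [List.getElem_append_left (by omega), List.getElem_append_left hi] at this
  · have := h (u.length + i) (by rw [List.length_append]; omega) (hD _ (by omega) (by omega))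
    rwa [List.getElem_append_right (by omega), List.getElem_append_right (by omega),
      getElem_congr_idx (show u.length + i - u.length = i by omega),
      getElem_congr_idx (show u.length + i + 1 - u.length = i + 1 by omega)] at this
  · rintro ⟨h1, h2⟩ i hi hiD
    rw [List.length_append] at hi
    rcases lt_trichotomy (i + 1) u.length with h | h | h
    · rw [List.getElem_append_left (by omega), List.getElem_append_left h]
      exact h1 i h hiD
    · exact absurd (h ▸ hp.resolve_left (by omega)) hiD
    · rw [List.getElem_append_right (by omega), List.getElem_append_right (by omega),
        getElem_congr_idx (show i + 1 - u.length = i - u.length + 1 by omega)]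
      exact h2 _ _

/-- The finite set of words with content `c`. -/
def wordsOf (c : Multiset α) : Finset (List α) := c.lists.toFinset

theorem mem_wordsOf {c : Multiset α} {w : List α} : w ∈ wordsOf c ↔ (w : Multiset α) = c := by
  rw [wordsOf, Multiset.mem_toFinset, Multiset.mem_lists_iff]
  exact eq_comm

theorem drop_eq_sort_sub {w : List α} {p : ℕ} (h : (w.drop p).Pairwise (· ≤ ·)) :
    w.drop p = ((w : Multiset α) - (w.take p : List α)).sort := by
  refine List.Perm.eq_of_pairwise' h (Multiset.pairwise_sort _ _) ?_
  have hw : (w : Multiset α) = (w.take p : List α) + (w.drop p : List α) := by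
    rw [Multiset.coe_add, List.take_append_drop]
  rw [← Multiset.coe_eq_coe, Multiset.sort_eq, hw, add_tsub_cancel_left]

theorem filter_take_wordsOf {c c' : Multiset α} (hle : c' ≤ c) {D : Finset ℕ}
    (hp : c'.card = 0 ∨ c'.card ∈ D) (hD : ∀ i, c'.card < i → i < c.card → i ∉ D) :
    {w ∈ wordsOf c | descentSet w ⊆ D ∧ (w.take c'.card : List α) = c'} =
      {u ∈ wordsOf c' | descentSet u ⊆ D}.image fun u => u ++ (c - c').sort := by
  have hsplit (u v : List α) (hu : u.length = c'.card) (hv : u.length + v.length = c.card) :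
      descentSet (u ++ v) ⊆ D ↔ descentSet u ⊆ D ∧ v.Pairwise (· ≤ ·) :=
    descentSet_append_subset_iff (hu ▸ hp) fun i h1 h2 => hD i (hu ▸ h1) (hv ▸ h2)
  ext w
  simp only [Finset.mem_filter, Finset.mem_image, mem_wordsOf]
  constructor
  · rintro ⟨rfl, hw, htake⟩
    have hdes := (hsplit (w.take c'.card) (w.drop c'.card)
      (by rw [← Multiset.coe_card, htake])
      (by rw [← List.length_append, List.take_append_drop, Multiset.coe_card])).1
      (by rwa [List.take_append_drop])
    refine ⟨_, ⟨htake, hdes.1⟩, ?_⟩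
    nth_rewrite 2 [← htake]
    rw [← drop_eq_sort_sub hdes.2, List.take_append_drop]
  · rintro ⟨u, ⟨rfl, hu⟩, rfl⟩
    refine ⟨?_, (hsplit u _ rfl ?_).2 ⟨hu, Multiset.pairwise_sort _ _⟩, ?_⟩
    · rw [← Multiset.coe_add, Multiset.sort_eq, add_tsub_cancel_of_le hle]
    · rw [Multiset.length_sort, Multiset.card_sub hle, ← Multiset.coe_card u]
      exact Nat.add_sub_cancel' (Multiset.card_le_card hle)
    · rw [Multiset.coe_card, List.take_left]

theorem card_wordsOf_descentSet_subset (c : Multiset α) (D : Finset ℕ) {p : ℕ} (hpc : p ≤ c.card)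
    (hp : p = 0 ∨ p ∈ D) (hD : ∀ i, p < i → i < c.card → i ∉ D) (Q : List α → Prop)
    [DecidablePred Q] :
    {w ∈ wordsOf c | descentSet w ⊆ D ∧ Q w}.card =
      ∑ c' ∈ Finset.Iic c with c'.card = p,
        {u ∈ wordsOf c' | descentSet u ⊆ D ∧ Q (u ++ (c - c').sort)}.card := by
  rw [Finset.card_eq_sum_card_fiberwise (f := fun w => ((w.take p : List α) : Multiset α))
    (t := {c' ∈ Finset.Iic c | c'.card = p})]
  · refine Finset.sum_congr rfl fun c' hc' => ?_
    rw [Finset.mem_filter, Finset.mem_Iic] at hc'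
    obtain ⟨hle, rfl⟩ := hc'
    simp only [← Finset.filter_filter]
    rw [Finset.filter_comm, Finset.filter_filter (descentSet · ⊆ D), filter_take_wordsOf hle hp hD,
      Finset.filter_image, Finset.card_image_of_injective _ (List.append_left_injective _)]
  · intro w hw
    obtain ⟨rfl, -⟩ := by simpa [mem_wordsOf] using hw
    simpa using ⟨(List.take_sublist p w).subperm, hpc⟩

end Descents

section Yamanouchi

open YoungDiagram

variable {r : ℕ}

/-- The alphabet of Yamanouchi words: the rows of an `r`-tuple of Young diagrams, in the order in
which adding the cells of a horizontal strip from its last row upwards is weakly increasing. -/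
abbrev RowLetter (r : ℕ) : Type := (Fin r ×ₗ ℕ)ᵒᵈ

/-- The letter that stands for row `a` of component `i`. -/
def rowLetter (i : Fin r) (a : ℕ) : RowLetter r := OrderDual.toDual (toLex (i, a))

theorem rowLetter_lt_iff {i i' : Fin r} {a a' : ℕ} :
    rowLetter i a < rowLetter i' a' ↔ i' < i ∨ (i' = i ∧ a' < a) := by
  rw [rowLetter, rowLetter, OrderDual.toDual_lt_toDual, Prod.Lex.toLex_lt_toLex]

theorem rowLetter_inj {i i' : Fin r} {a a' : ℕ} :
    rowLetter i a = rowLetter i' a' ↔ i = i' ∧ a = a' := by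
  rw [rowLetter, rowLetter, OrderDual.toDual_inj, toLex_inj, Prod.mk_inj]

theorem exists_rowLetter (x : RowLetter r) : ∃ i a, rowLetter i a = x :=
  ⟨(ofLex (OrderDual.ofDual x)).1, (ofLex (OrderDual.ofDual x)).2, rfl⟩

/-- Yamanouchi words: every prefix has an `r`-tuple of partitions as content. -/
def IsYamanouchi (y : List (RowLetter r)) : Prop :=
  ∀ u, u <+: y → ∀ i a, u.count (rowLetter i (a + 1)) ≤ u.count (rowLetter i a)

/-- The content of the Yamanouchi words that stand for the `r`-partition `lam`: the letter of each
row occurs as often as the row has cells. -/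
def rowContent (lam : Fin r → YoungDiagram) : Multiset (RowLetter r) :=
  ∑ i, (lam i).cells.val.map fun c => rowLetter i c.1

theorem count_rowContent (lam : Fin r → YoungDiagram) (i : Fin r) (a : ℕ) :
    (rowContent lam).count (rowLetter i a) = (lam i).rowLen a := by
  rw [rowContent, Multiset.count_sum', Finset.sum_eq_single i]
  · rw [Multiset.count_map, rowLen_eq_card, row, Finset.card_def, Finset.filter_val]
    simp only [rowLetter_inj, true_and, eq_comm]
  · intro j _ hj
    rw [Multiset.count_eq_zero, Multiset.mem_map]
    rintro ⟨c, _, h⟩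
    exact hj (rowLetter_inj.1 h).1
  · exact fun h => absurd (Finset.mem_univ i) h

theorem card_rowContent (lam : Fin r → YoungDiagram) :
    (rowContent lam).card = ∑ i, (lam i).card := by
  rw [rowContent, Multiset.card_sum]
  exact Finset.sum_congr rfl fun i _ => Multiset.card_map _ _

theorem rowContent_injective : Function.Injective (rowContent (r := r)) := fun lam nu h =>
  funext fun i => rowLen_injective <| funext fun a => by
    rw [← count_rowContent, h, count_rowContent]

theorem rowContent_le_iff {nu lam : Fin r → YoungDiagram} :
    rowContent nu ≤ rowContent lam ↔ ∀ i a, (nu i).rowLen a ≤ (lam i).rowLen a := by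
  simp only [← count_rowContent]
  refine Multiset.le_iff_count.trans ⟨fun h i a => h _, fun h x => ?_⟩
  obtain ⟨i, a, rfl⟩ := exists_rowLetter x
  exact h i a

theorem IsYamanouchi.of_prefix {u y : List (RowLetter r)} (h : IsYamanouchi y) (hu : u <+: y) :
    IsYamanouchi u :=
  fun v hv => h v (hv.trans hu)

theorem exists_rowContent_eq {y : List (RowLetter r)} (h : IsYamanouchi y) :
    ∃ lam, rowContent lam = (y : Multiset (RowLetter r)) := by
  have hanti (i : Fin r) : Antitone fun a => y.count (rowLetter i a) :=
    antitone_nat_of_succ_le fun a => h y List.prefix_rfl i a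
  have hzero (i : Fin r) : ∃ N, y.count (rowLetter i N) = 0 := by
    have hinj : Function.Injective (rowLetter i) := fun a b hab => (rowLetter_inj.1 hab).2
    obtain ⟨N, hN⟩ := (y.toFinset.finite_toSet.preimage hinj.injOn).exists_notMem
    exact ⟨N, List.count_eq_zero.2 fun hmem => hN (List.mem_toFinset.2 hmem)⟩
  choose N hN using hzero
  choose lam hlam using fun i => exists_rowLen_eq (hanti i) (hN i)
  refine ⟨lam, Multiset.ext.2 fun x => ?_⟩
  obtain ⟨i, a, rfl⟩ := exists_rowLetter x
  rw [count_rowContent, hlam, Multiset.coe_count]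

theorem filter_le_prefix {α : Type*} [LinearOrder α] {v : List α} (hv : v.Pairwise (· ≤ ·))
    (z : α) : v.filter (· ≤ z) <+: v := by
  induction v with
  | nil => exact List.prefix_rfl
  | cons x t ih =>
    obtain ⟨hx, ht⟩ := List.pairwise_cons.1 hv
    by_cases hxz : x ≤ z
    · rw [List.filter_cons_of_pos (by simpa using hxz), List.prefix_cons_inj]
      exact ih ht
    · rw [List.filter_eq_nil_iff.2]
      · exact List.nil_prefix
      · simpa using ⟨not_le.1 hxz, fun y hy => (not_le.1 hxz).trans_le (hx y hy)⟩

/-- A weakly increasing word contains the letters of row `a + 1` before those of row `a`, which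
makes the prefix condition hardest to satisfy just after the letters of row `a + 1`. -/
theorem isYamanouchi_append_iff {u v : List (RowLetter r)} (hv : v.Pairwise (· ≤ ·)) :
    IsYamanouchi (u ++ v) ↔ IsYamanouchi u ∧
      ∀ i a, (u ++ v).count (rowLetter i (a + 1)) ≤ u.count (rowLetter i a) := by
  constructor
  · intro h
    refine ⟨h.of_prefix (List.prefix_append u v), fun i a => ?_⟩
    have hlt : rowLetter i (a + 1) < rowLetter i a :=
      rowLetter_lt_iff.2 (.inr ⟨rfl, a.lt_succ_self⟩)
    have hzero : (v.filter (· ≤ rowLetter i (a + 1))).count (rowLetter i a) = 0 :=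
      List.count_eq_zero.2 fun hmem => hlt.not_ge (by simpa using List.of_mem_filter hmem)
    have hcount := h (u ++ v.filter (· ≤ rowLetter i (a + 1)))
      ((List.prefix_append_right_inj u).2 (filter_le_prefix hv _)) i a
    rwa [List.count_append, List.count_append, List.count_filter (by simp), hzero, add_zero,
      ← List.count_append] at hcount
  · rintro ⟨hu, hcount⟩ w hw i a
    rcases List.prefix_or_prefix_of_prefix hw (List.prefix_append u v) with h | h
    · exact hu w h i a
    · exact ((hw.sublist.count_le _).trans (hcount i a)).trans (h.sublist.count_le _)

theorem isYamanouchi_append_sort_iff {nu lam : Fin r → YoungDiagram}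
    (hle : rowContent nu ≤ rowContent lam) {u : List (RowLetter r)}
    (hu : (u : Multiset (RowLetter r)) = rowContent nu) :
    IsYamanouchi (u ++ (rowContent lam - rowContent nu).sort) ↔
      IsYamanouchi u ∧ ∀ i, IsHStrip (nu i) (lam i) := by
  have hcount (x) : (u ++ (rowContent lam - rowContent nu).sort).count x =
      (rowContent lam).count x := by
    rw [← Multiset.coe_count, ← Multiset.coe_add, Multiset.sort_eq, hu, add_tsub_cancel_of_le hle]
  rw [isYamanouchi_append_iff (Multiset.pairwise_sort _ _)]
  simp only [hcount, ← Multiset.coe_count, hu, count_rowContent]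
  exact and_congr_right fun _ =>
    ⟨fun h i a => ⟨h i a, rowContent_le_iff.1 hle i a⟩, fun h i a => (h i a).1⟩

open Classical in
/-- The number of Yamanouchi words of content `lam` with descents in `D`, i.e. of standard
`r`-tableaux of shape `lam` with descents in `D`. -/
noncomputable def yamanouchiCount (D : Finset ℕ) (lam : Fin r → YoungDiagram) : ℕ :=
  {y ∈ wordsOf (rowContent lam) | descentSet y ⊆ D ∧ IsYamanouchi y}.card

open Classical in
theorem yamanouchiCount_eq_sum (lam : Fin r → YoungDiagram) (D : Finset ℕ) {p M : ℕ}
    (hpc : p ≤ ∑ i, (lam i).card) (hM : p ≤ M)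
    (hp : p = 0 ∨ p ∈ D) (hD : ∀ i, p < i → i < ∑ i, (lam i).card → i ∉ D) :
    yamanouchiCount D lam = ∑ nu ∈ Fintype.piFinset fun _ => cardLE M with
      ∑ i, (nu i).card = p ∧ ∀ i, IsHStrip (nu i) (lam i), yamanouchiCount D nu := by
  rw [← card_rowContent] at hpc hD
  rw [yamanouchiCount, card_wordsOf_descentSet_subset _ D hpc hp hD IsYamanouchi]
  refine (Finset.sum_of_injOn rowContent rowContent_injective.injOn ?_ ?_ ?_).symm
  · intro nu hnu
    obtain ⟨-, hcard, hstrip⟩ := Finset.mem_filter.1 (Finset.mem_coe.1 hnu)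
    rw [Finset.mem_coe, Finset.mem_filter, Finset.mem_Iic, card_rowContent]
    exact ⟨rowContent_le_iff.2 fun i a => (hstrip i a).2, hcard⟩
  · intro c' hc'
    rw [Finset.mem_filter, Finset.mem_Iic] at hc'
    contrapose!
    rw [Finset.card_ne_zero]
    rintro ⟨u, hu⟩
    rw [Finset.mem_filter, mem_wordsOf] at hu
    obtain ⟨rfl, -, hY⟩ := hu
    obtain ⟨nu, hnu⟩ := exists_rowContent_eq (hY.of_prefix (List.prefix_append _ _))
    rw [← hnu, card_rowContent] at hc'
    rw [← hnu] at hY ⊢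
    refine ⟨nu, Finset.mem_filter.2 ⟨Fintype.mem_piFinset.2 fun i => mem_cardLE.2 ?_, hc'.2,
      ((isYamanouchi_append_sort_iff hc'.1 hnu.symm).1 hY).2⟩, rfl⟩
    exact (Finset.single_le_sum (f := fun i => (nu i).card) (fun _ _ => Nat.zero_le _)
      (Finset.mem_univ i)).trans (hc'.2.le.trans hM)
  · intro nu hnu
    obtain ⟨-, -, hstrip⟩ := Finset.mem_filter.1 hnu
    refine congrArg Finset.card (Finset.filter_congr fun u hu => ?_)
    rw [isYamanouchi_append_sort_iff (rowContent_le_iff.2 fun i a => (hstrip i a).2)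
      (mem_wordsOf.1 hu), and_iff_left hstrip]

end Yamanouchi

section Words

variable {r : ℕ}

/-- The bijection between letters and variables that underlies the monomials `x^μ`. -/
def letterEquiv (r : ℕ) : ColoredLetter r ≃ VarIndex r where
  toFun a := (a.color, a.value)
  invFun p := toLex (OrderDual.toDual p.1, p.2)
  left_inv _ := rfl
  right_inv _ := rfl

/-- The content of the words of coloured letters whose exponent vector is `m`. -/
noncomputable def letterContent (m : VarIndex r →₀ ℕ) : Multiset (ColoredLetter r) :=
  (Finsupp.toMultiset m).map (letterEquiv r).symm

theorem card_letterContent (m : VarIndex r →₀ ℕ) : (letterContent m).card = m.degree := by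
  rw [letterContent, Multiset.card_map, Finsupp.card_toMultiset]
  rfl

theorem letterContent_le_iff {h m : VarIndex r →₀ ℕ} :
    letterContent h ≤ letterContent m ↔ h ≤ m := by
  rw [letterContent, letterContent, Multiset.map_le_map_iff (letterEquiv r).symm.injective]
  exact Finsupp.orderIsoMultiset.le_iff_le

theorem letterContent_injective : Function.Injective (letterContent (r := r)) := fun _ _ h =>
  le_antisymm (letterContent_le_iff.1 h.le) (letterContent_le_iff.1 h.ge)

theorem letterContent_surjective : Function.Surjective (letterContent (r := r)) := fun c =>
  ⟨Multiset.toFinsupp (c.map (letterEquiv r)), by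
    rw [letterContent, Multiset.toFinsupp_toMultiset, Multiset.map_map]
    simp⟩

/-- The number of words with exponent vector `m` and descents in `D`. -/
noncomputable def wordCount (D : Finset ℕ) (m : VarIndex r →₀ ℕ) : ℕ :=
  {w ∈ wordsOf (letterContent m) | descentSet w ⊆ D}.card

theorem wordCount_eq_sum (m : VarIndex r →₀ ℕ) (D : Finset ℕ) {p : ℕ} (hpm : p ≤ m.degree)
    (hp : p = 0 ∨ p ∈ D) (hD : ∀ i, p < i → i < m.degree → i ∉ D) :
    wordCount D m = ∑ h ∈ Finset.Iic m with h.degree = p, wordCount D h := by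
  rw [← card_letterContent] at hpm hD
  have hrec := card_wordsOf_descentSet_subset _ D hpm hp hD fun _ => True
  simp only [and_true] at hrec
  rw [wordCount, hrec]
  refine (Finset.sum_nbij letterContent (fun h hh => ?_) letterContent_injective.injOn
    (fun c hc => ?_) fun h _ => rfl).symm
  · simpa only [Finset.mem_filter, Finset.mem_Iic, letterContent_le_iff, card_letterContent]
      using hh
  · obtain ⟨h, rfl⟩ := letterContent_surjective c
    refine ⟨h, ?_, rfl⟩
    simpa only [Finset.coe_filter, Set.mem_ofPred_eq, Finset.mem_Iic, letterContent_le_iff,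
      card_letterContent] using hc

theorem exists_last_mem (D : Finset ℕ) {n : ℕ} (hn : 0 < n) :
    ∃ p < n, (p = 0 ∨ p ∈ D) ∧ ∀ i, p < i → i < n → i ∉ D := by
  obtain ⟨p, hp, hmax⟩ := (insert 0 {i ∈ D | i < n}).exists_max_image id ⟨0, by simp⟩
  simp only [Finset.mem_insert, Finset.mem_filter, id] at hp hmax
  refine ⟨p, by omega, hp.imp_right And.left, fun i hi hin hiD => ?_⟩
  exact hi.not_ge (hmax i (.inr ⟨hiD, hin⟩))

theorem rowContent_bot : rowContent (fun _ : Fin r => ⊥) = 0 := by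
  rw [← Multiset.card_eq_zero, card_rowContent]
  simp [YoungDiagram.card]

theorem yamanouchiCount_bot (D : Finset ℕ) : yamanouchiCount D (fun _ : Fin r => ⊥) = 1 := by
  classical
  have hnil : IsYamanouchi ([] : List (RowLetter r)) := fun u hu => by simp [List.prefix_nil.1 hu]
  rw [yamanouchiCount, rowContent_bot, Finset.card_eq_one]
  refine ⟨[], Finset.ext fun w => ?_⟩
  rw [Finset.mem_filter, mem_wordsOf, Multiset.coe_eq_zero, Finset.mem_singleton]
  exact ⟨And.left, by rintro rfl; exact ⟨rfl, Finset.empty_subset D, hnil⟩⟩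

theorem wordCount_zero (D : Finset ℕ) : wordCount D (0 : VarIndex r →₀ ℕ) = 1 := by
  rw [wordCount, letterContent, map_zero, Multiset.map_zero, Finset.card_eq_one]
  refine ⟨[], Finset.ext fun w => ?_⟩
  rw [Finset.mem_filter, mem_wordsOf, Multiset.coe_eq_zero, Finset.mem_singleton]
  exact ⟨And.left, by rintro rfl; exact ⟨rfl, Finset.empty_subset D⟩⟩

theorem sum_yamanouchiCount_mul_schurCount_zero (D : Finset ℕ) (M : ℕ) :
    ∑ lam ∈ Fintype.piFinset fun _ : Fin r => cardLE M,
      yamanouchiCount D lam * schurCount lam 0 = 1 := by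
  have hcurry (i : Fin r) : (0 : VarIndex r →₀ ℕ).curry i = 0 := rfl
  rw [Finset.sum_eq_single fun _ => ⊥]
  · simp only [yamanouchiCount_bot, schurCount, hcurry, kostka_bot_zero, Finset.prod_const_one,
      mul_one]
  · intro lam _ hne
    obtain ⟨i, hi⟩ := Function.ne_iff.1 hne
    rw [schurCount, Finset.prod_eq_zero (Finset.mem_univ i) (kostka_zero_of_ne_bot hi), mul_zero]
  · exact fun h => absurd (Fintype.mem_piFinset.2 fun i => mem_cardLE.2 (Nat.zero_le M)) h

theorem sum_yamanouchiCount_mul_schurCount (D : Finset ℕ) (m : VarIndex r →₀ ℕ) {p M : ℕ}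
    (hpm : p ≤ m.degree) (hM : m.degree ≤ M) (hp : p = 0 ∨ p ∈ D)
    (hD : ∀ i, p < i → i < m.degree → i ∉ D) :
    ∑ lam ∈ Fintype.piFinset fun _ => cardLE M, yamanouchiCount D lam * schurCount lam m =
      ∑ h ∈ Finset.Iic m with h.degree = p,
        ∑ nu ∈ Fintype.piFinset fun _ => cardLE M, yamanouchiCount D nu * schurCount nu h := by
  classical
  set P := Fintype.piFinset fun _ : Fin r => cardLE M
  have hcard {nu : Fin r → YoungDiagram} {h : VarIndex r →₀ ℕ}
      (hne : yamanouchiCount D nu * schurCount nu h ≠ 0) : ∑ i, (nu i).card = h.degree :=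
    sum_card_eq_of_schurCount_ne_zero (right_ne_zero_of_mul hne)
  calc ∑ lam ∈ P, yamanouchiCount D lam * schurCount lam m
    _ = ∑ lam ∈ P, ∑ nu ∈ P with ∑ i, (nu i).card = p ∧ ∀ i, IsHStrip (nu i) (lam i),
          yamanouchiCount D nu * schurCount lam m := by
      refine Finset.sum_congr rfl fun lam _ => ?_
      rw [← Finset.sum_mul]
      rcases eq_or_ne (schurCount lam m) 0 with hzero | hne
      · rw [hzero, mul_zero, mul_zero]
      · have hlam := sum_card_eq_of_schurCount_ne_zero hne
        rw [yamanouchiCount_eq_sum lam D (hlam ▸ hpm) (hpm.trans hM) hp (hlam ▸ hD)]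
    _ = ∑ nu ∈ P with ∑ i, (nu i).card = p, ∑ lam ∈ P with ∀ i, IsHStrip (nu i) (lam i),
          yamanouchiCount D nu * schurCount lam m :=
      Finset.sum_comm' fun lam nu => by simp only [Finset.mem_filter]; tauto
    _ = ∑ nu ∈ P with ∑ i, (nu i).card = p, ∑ h ∈ Finset.Iic m with h.degree = p,
          yamanouchiCount D nu * schurCount nu h := by
      refine Finset.sum_congr rfl fun nu hnu => ?_
      rw [← Finset.mul_sum, sum_schurCount_isHStrip nu hM, Finset.mul_sum]
      exact (Finset.sum_filter_of_ne fun h _ hne =>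
        (hcard hne).symm.trans (Finset.mem_filter.1 hnu).2).symm
    _ = ∑ h ∈ Finset.Iic m with h.degree = p, ∑ nu ∈ P,
          yamanouchiCount D nu * schurCount nu h := by
      rw [Finset.sum_comm]
      refine Finset.sum_congr rfl fun h hh => Finset.sum_filter_of_ne fun nu _ hne => ?_
      exact (hcard hne).trans (Finset.mem_filter.1 hh).2

/-- The enumerative content of the Robinson–Schensted–Knuth correspondence. Both sides satisfy the
same recursion, which removes the letters after the last descent position allowed by `D`. -/
theorem wordCount_eq_sum_yamanouchiCount (D : Finset ℕ) (m : VarIndex r →₀ ℕ) {M : ℕ}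
    (hM : m.degree ≤ M) :
    wordCount D m =
      ∑ lam ∈ Fintype.piFinset fun _ => cardLE M, yamanouchiCount D lam * schurCount lam m := by
  induction hn : m.degree using Nat.strong_induction_on generalizing m with
  | _ n ih =>
  subst hn
  rcases Nat.eq_zero_or_pos m.degree with hzero | hpos
  · rw [(Finsupp.degree_eq_zero_iff m).1 hzero, wordCount_zero,
      sum_yamanouchiCount_mul_schurCount_zero]
  · obtain ⟨p, hpm, hp, hD⟩ := exists_last_mem D hpos
    rw [wordCount_eq_sum m D hpm.le hp hD,
      sum_yamanouchiCount_mul_schurCount D m hpm.le hM hp hD]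
    refine Finset.sum_congr rfl fun h hh => ?_
    obtain ⟨-, rfl⟩ := Finset.mem_filter.1 hh
    exact ih _ hpm h (hpm.le.trans hM) rfl

end Words

section Tableaux

theorem count_take_succ {α : Type*} [DecidableEq α] {y : List α} {t : ℕ} (ht : t < y.length)
    (x : α) : (y.take (t + 1)).count x = (y.take t).count x + if y[t] = x then 1 else 0 := by
  simp only [List.take_succ_eq_append_getElem ht, List.count_append, List.count_singleton,
    beq_iff_eq]

namespace StdRTableau

open YoungDiagram

variable {r n : ℕ}

theorem exists_cell (T : StdRTableau r n) (t : Fin n) :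
    ∃ p ∈ rCells T.shape, T.tab p.1 p.2.1 p.2.2 = t + 1 :=
  T.standard.surjOn ⟨Nat.succ_le_succ (Nat.zero_le _), t.2⟩

/-- The cell with entry `t + 1`. -/
noncomputable def cellOf (T : StdRTableau r n) (t : Fin n) : Fin r × ℕ × ℕ :=
  (T.exists_cell t).choose

theorem cellOf_mem (T : StdRTableau r n) (t : Fin n) : T.cellOf t ∈ rCells T.shape :=
  (T.exists_cell t).choose_spec.1

theorem tab_cellOf (T : StdRTableau r n) (t : Fin n) :
    T.tab (T.cellOf t).1 (T.cellOf t).2.1 (T.cellOf t).2.2 = t + 1 :=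
  (T.exists_cell t).choose_spec.2

theorem cellOf_eq_iff {T : StdRTableau r n} {t : Fin n} {p : Fin r × ℕ × ℕ} :
    T.cellOf t = p ↔ p ∈ rCells T.shape ∧ T.tab p.1 p.2.1 p.2.2 = t + 1 := by
  constructor
  · rintro rfl
    exact ⟨T.cellOf_mem t, T.tab_cellOf t⟩
  · rintro ⟨hp, h⟩
    exact T.standard.injOn (T.cellOf_mem t) hp ((T.tab_cellOf t).trans h.symm)

theorem tab_mem_Icc (T : StdRTableau r n) {i : Fin r} {a b : ℕ} (h : (a, b) ∈ T.shape i) :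
    T.tab i a b ∈ Set.Icc 1 n :=
  T.standard.mapsTo (show ((i, a, b) : Fin r × ℕ × ℕ) ∈ rCells T.shape from h)

theorem mem_and_tab_lt_iff (T : StdRTableau r n) {i : Fin r} {a b c : ℕ}
    (hc : (a, c) ∈ T.shape i) :
    (a, b) ∈ T.shape i ∧ T.tab i a b < T.tab i a c ↔ b < c := by
  constructor
  · rintro ⟨hb, hlt⟩
    by_contra! hcb
    exact hlt.not_ge ((T.tab i).row_weak_of_le hcb hb)
  · intro hbc
    have hb := (T.shape i).up_left_mem le_rfl hbc.le hc
    refine ⟨hb, ((T.tab i).row_weak hbc hc).lt_of_ne fun h => hbc.ne ?_⟩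
    have hcell : ((i, a, b) : Fin r × ℕ × ℕ) = (i, a, c) := T.standard.injOn hb hc h
    exact congrArg (fun p => p.2.2) hcell

/-- The word of the rows that contain the entries `1, …, n`. -/
noncomputable def rowWord (T : StdRTableau r n) : List (RowLetter r) :=
  List.ofFn fun t => rowLetter (T.cellOf t).1 (T.cellOf t).2.1

theorem length_rowWord (T : StdRTableau r n) : T.rowWord.length = n := List.length_ofFn

theorem getElem_rowWord (T : StdRTableau r n) {t : ℕ} (ht : t < T.rowWord.length) :
    T.rowWord[t] = rowLetter (T.cellOf ⟨t, T.length_rowWord ▸ ht⟩).1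
      (T.cellOf ⟨t, T.length_rowWord ▸ ht⟩).2.1 := by
  simp only [rowWord, List.getElem_ofFn]

theorem lt_count_take_rowWord (T : StdRTableau r n) (i : Fin r) (a b : ℕ) {t : ℕ} (ht : t ≤ n) :
    b < (T.rowWord.take t).count (rowLetter i a) ↔ (a, b) ∈ T.shape i ∧ T.tab i a b ≤ t := by
  induction t generalizing b with
  | zero =>
    simp only [List.take_zero, List.count_nil, not_lt_zero, false_iff, not_and, not_le]
    exact fun h => (T.tab_mem_Icc h).1
  | succ t ih =>
    have ht' : t < T.rowWord.length := by rwa [length_rowWord]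
    have hcell (c : ℕ) : T.cellOf ⟨t, ht⟩ = (i, a, c) ↔ (a, c) ∈ T.shape i ∧ T.tab i a c = t + 1 :=
      cellOf_eq_iff
    have hsucc : (a, b) ∈ T.shape i ∧ T.tab i a b ≤ t + 1 ↔
        b < (T.rowWord.take t).count (rowLetter i a) ∨ T.cellOf ⟨t, ht⟩ = (i, a, b) := by
      rw [ih b (Nat.le_of_succ_le ht), hcell, ← and_or_left, Nat.le_succ_iff]
    rw [count_take_succ ht', getElem_rowWord, hsucc]
    split_ifs with hrow
    · have hc : T.cellOf ⟨t, ht⟩ = (i, a, (T.cellOf ⟨t, ht⟩).2.2) :=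
        Prod.ext (rowLetter_inj.1 hrow).1 (Prod.ext (rowLetter_inj.1 hrow).2 rfl)
      set c := (T.cellOf ⟨t, ht⟩).2.2
      obtain ⟨hmem, htab⟩ := (hcell c).1 hc
      have hcount : (T.rowWord.take t).count (rowLetter i a) = c := eq_of_forall_lt_iff fun b => by
        rw [ih b (Nat.le_of_succ_le ht), ← T.mem_and_tab_lt_iff hmem, htab, Nat.lt_succ_iff]
      rw [hcount, hc, Prod.mk_inj, Prod.mk_inj, Nat.lt_succ_iff_lt_or_eq, eq_comm (a := b)]
      simp only [true_and]
    · rw [add_zero]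
      exact (or_iff_left fun h => hrow (by rw [h])).symm

theorem coe_rowWord (T : StdRTableau r n) :
    (T.rowWord : Multiset (RowLetter r)) = rowContent T.shape := by
  ext x
  obtain ⟨i, a, rfl⟩ := exists_rowLetter x
  rw [count_rowContent, Multiset.coe_count]
  refine eq_of_forall_lt_iff fun b => ?_
  have hcount := T.lt_count_take_rowWord i a b le_rfl
  rw [List.take_of_length_le T.length_rowWord.le] at hcount
  rw [hcount, ← mem_iff_lt_rowLen]
  exact and_iff_left_of_imp fun h => (T.tab_mem_Icc h).2

theorem sum_card_shape (T : StdRTableau r n) : ∑ i, (T.shape i).card = n := by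
  rw [← card_rowContent, ← T.coe_rowWord, Multiset.coe_card, length_rowWord]

theorem isYamanouchi_rowWord (T : StdRTableau r n) : IsYamanouchi T.rowWord := by
  intro u hu i a
  have hlength : u.length ≤ n := T.length_rowWord ▸ hu.length_le
  rw [List.prefix_iff_eq_take.1 hu]
  refine le_of_forall_lt fun b hb => ?_
  rw [T.lt_count_take_rowWord i _ b hlength] at hb ⊢
  exact ⟨(T.shape i).up_left_mem (Nat.le_succ a) le_rfl hb.1,
    ((T.tab i).col_strict (Nat.lt_succ_self a) hb.1).le.trans hb.2⟩

theorem descentSet_rowWord (T : StdRTableau r n) : descentSet T.rowWord = T.Des := by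
  classical
  ext i
  rw [mem_descentSet, Des, Finset.mem_filter, Finset.mem_Ico]
  constructor
  · rintro ⟨h1, hlt, hdes⟩
    have hn : i < n := T.length_rowWord ▸ hlt
    rw [getElem_rowWord, getElem_rowWord, rowLetter_lt_iff] at hdes
    have htab := T.tab_cellOf ⟨i - 1, by omega⟩
    rw [Nat.sub_add_cancel h1] at htab
    exact ⟨⟨h1, hn⟩, _, T.cellOf_mem _, _, T.cellOf_mem _, htab, T.tab_cellOf ⟨i, hn⟩, hdes⟩
  · rintro ⟨⟨h1, hn⟩, p, hp, p', hp', htab, htab', hlt⟩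
    have hcell : T.cellOf ⟨i - 1, by omega⟩ = p :=
      cellOf_eq_iff.2 ⟨hp, by rw [htab, Nat.sub_add_cancel h1]⟩
    have hcell' : T.cellOf ⟨i, hn⟩ = p' := cellOf_eq_iff.2 ⟨hp', htab'⟩
    refine ⟨h1, T.length_rowWord.symm ▸ hn, ?_⟩
    rwa [getElem_rowWord, getElem_rowWord, rowLetter_lt_iff, hcell, hcell']

theorem rowWord_injective : Function.Injective (rowWord (r := r) (n := n)) := by
  rintro ⟨lam, tab, hT⟩ ⟨lam', tab', hT'⟩ h
  obtain rfl : lam = lam' :=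
    rowContent_injective ((coe_rowWord _).symm.trans ((congrArg _ h).trans (coe_rowWord _)))
  set T : StdRTableau r n := ⟨lam, tab, hT⟩
  set T' : StdRTableau r n := ⟨lam, tab', hT'⟩
  obtain rfl : tab = tab' := by
    refine funext fun i => SemistandardYoungTableau.ext fun a b => ?_
    by_cases hmem : (a, b) ∈ lam i
    · have hle (t) (ht : t ≤ n) : tab i a b ≤ t ↔ tab' i a b ≤ t := by
        have hiff := T.lt_count_take_rowWord i a b ht
        rwa [h, T'.lt_count_take_rowWord i a b ht, and_congr_right_iff, forall_prop_of_true hmem,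
          iff_comm] at hiff
      exact le_antisymm ((hle _ (T'.tab_mem_Icc hmem).2).2 le_rfl)
        ((hle _ (T.tab_mem_Icc hmem).2).1 le_rfl)
    · rw [(tab i).zeros hmem, (tab' i).zeros hmem]
  rfl

end StdRTableau

section Position

variable {α : Type*} [DecidableEq α] {y : List α} {x : α} {b t : ℕ}

/-- The position, counted from `1`, of the occurrence of `x` in `y` that has `b` occurrences before
it; it is `0` if there are at most `b` occurrences, as `sInf ∅ = 0`. -/
noncomputable def position (y : List α) (x : α) (b : ℕ) : ℕ := sInf {t | b < (y.take t).count x}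

theorem position_of_count_le (h : y.count x ≤ b) : position y x b = 0 :=
  Nat.sInf_eq_zero.2 (.inr (Set.eq_empty_of_forall_notMem fun t ht =>
    (Nat.lt_of_lt_of_le ht ((List.take_sublist t y).count_le x)).not_ge h))

theorem position_le_iff (h : b < y.count x) : position y x b ≤ t ↔ b < (y.take t).count x := by
  have hne : {t | b < (y.take t).count x}.Nonempty := ⟨y.length, by simpa using h⟩
  refine ⟨fun hle => ?_, fun hlt => Nat.sInf_le hlt⟩
  exact (show b < (y.take (position y x b)).count x from Nat.sInf_mem hne).trans_le
    ((List.take_sublist_take_left hle).count_le _)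

theorem position_mono (h : b < y.count x) {c : ℕ} (hc : c ≤ b) :
    position y x c ≤ position y x b :=
  (position_le_iff (hc.trans_lt h)).2 (hc.trans_lt ((position_le_iff h).1 le_rfl))

theorem position_eq_succ_iff (h : b < y.count x) (ht : t < y.length) :
    position y x b = t + 1 ↔ y[t] = x ∧ b = (y.take t).count x := by
  have hle := position_le_iff (t := t) h
  have hle' := position_le_iff (t := t + 1) h
  rw [count_take_succ ht] at hle'
  split_ifs at hle' with hx
  · simp only [hx, true_and]
    omega
  · simp only [hx, false_and, iff_false]
    omega

theorem exists_position_eq_succ (h : b < y.count x) :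
    ∃ t, ∃ ht : t < y.length, position y x b = t + 1 ∧ y[t] = x ∧ b = (y.take t).count x := by
  have hpos : ¬position y x b ≤ 0 := by simp [position_le_iff h]
  have hle : position y x b ≤ y.length := by simpa [position_le_iff h] using h
  have hsucc : position y x b = position y x b - 1 + 1 := by omega
  have ht : position y x b - 1 < y.length := by omega
  exact ⟨_, ht, hsucc, (position_eq_succ_iff h ht).1 hsucc⟩

end Position

section OfWord

open YoungDiagram

variable {r n : ℕ} {lam : Fin r → YoungDiagram} {y : List (RowLetter r)}

theorem lt_count_rowLetter_iff (hy : (y : Multiset (RowLetter r)) = rowContent lam) {i : Fin r}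
    {a b : ℕ} : b < y.count (rowLetter i a) ↔ (a, b) ∈ lam i := by
  rw [mem_iff_lt_rowLen, ← count_rowContent, ← hy, Multiset.coe_count]

theorem position_lt_position (hY : IsYamanouchi y) {i : Fin r} {a a' b : ℕ} (ha : a < a')
    (hb : b < y.count (rowLetter i a')) :
    position y (rowLetter i a) b < position y (rowLetter i a') b := by
  have anti (t : ℕ) : Antitone fun a => (y.take t).count (rowLetter i a) :=
    antitone_nat_of_succ_le fun a => hY _ (List.take_prefix _ _) i a
  have hb' : b < y.count (rowLetter i a) :=
    hb.trans_le (by simpa using anti y.length ha.le)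
  obtain ⟨t, ht, hsucc, hyt, hcount⟩ := exists_position_eq_succ hb
  have hlt := anti (t + 1) ha.le
  simp only [count_take_succ ht, hyt, rowLetter_inj, ha.ne', and_false, if_true, if_false] at hlt
  rw [hsucc, Nat.lt_succ_iff, position_le_iff hb']
  omega

/-- The tableau of the positions of the letters of a Yamanouchi word. -/
noncomputable def positionTableau (hy : (y : Multiset (RowLetter r)) = rowContent lam)
    (hY : IsYamanouchi y) (i : Fin r) : SemistandardYoungTableau (lam i) where
  entry a b := position y (rowLetter i a) b
  row_weak' hb hc := position_mono ((lt_count_rowLetter_iff hy).2 hc) hb.le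
  col_strict' ha hc := position_lt_position hY ha ((lt_count_rowLetter_iff hy).2 hc)
  zeros' h := position_of_count_le (not_lt.1 fun hlt => h ((lt_count_rowLetter_iff hy).1 hlt))

theorem bijOn_position (hy : (y : Multiset (RowLetter r)) = rowContent lam) :
    Set.BijOn (fun p : Fin r × ℕ × ℕ => position y (rowLetter p.1 p.2.1) p.2.2) (rCells lam)
      (Set.Icc 1 y.length) := by
  have hex {p : Fin r × ℕ × ℕ} (hp : p ∈ rCells lam) :=
    exists_position_eq_succ ((lt_count_rowLetter_iff (i := p.1) (a := p.2.1) (b := p.2.2) hy).2 hp)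
  refine ⟨fun p hp => ?_, fun p hp p' hp' h => ?_, fun v hv => ?_⟩
  · obtain ⟨t, ht, hsucc, -⟩ := hex hp
    exact ⟨t.succ_pos.trans_eq hsucc.symm, hsucc.trans_le ht⟩
  · obtain ⟨t, ht, hsucc, hyt, hcount⟩ := hex hp
    obtain ⟨t', ht', hsucc', hyt', hcount'⟩ := hex hp'
    obtain rfl : t = t' := Nat.succ_injective (hsucc.symm.trans (h.trans hsucc'))
    obtain ⟨hi, ha⟩ := rowLetter_inj.1 (hyt.symm.trans hyt')
    exact Prod.ext hi (Prod.ext ha (by rw [hcount, hcount', hi, ha]))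
  · obtain ⟨t, rfl⟩ : ∃ t, v = t + 1 := ⟨v - 1, (Nat.sub_add_cancel hv.1).symm⟩
    have ht : t < y.length := hv.2
    obtain ⟨i, a, hyt⟩ := exists_rowLetter y[t]
    have hlt : (y.take t).count (rowLetter i a) < y.count (rowLetter i a) := by
      refine Nat.lt_of_succ_le (le_trans ?_ ((List.take_sublist (t + 1) y).count_le _))
      rw [count_take_succ ht, if_pos hyt.symm]
    exact ⟨(i, a, _), (lt_count_rowLetter_iff hy).1 hlt,
      (position_eq_succ_iff hlt ht).2 ⟨hyt.symm, rfl⟩⟩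

theorem exists_rowWord_eq (hy : (y : Multiset (RowLetter r)) = rowContent lam)
    (hY : IsYamanouchi y) : ∃ T : StdRTableau r y.length, T.shape = lam ∧ T.rowWord = y := by
  let T : StdRTableau r y.length := ⟨lam, positionTableau hy hY, bijOn_position hy⟩
  refine ⟨T, rfl, List.ext_getElem T.length_rowWord fun t ht ht' => ?_⟩
  rw [T.getElem_rowWord]
  exact ((position_eq_succ_iff ((lt_count_rowLetter_iff hy).2 (T.cellOf_mem _)) ht').1
    (T.tab_cellOf ⟨t, ht'⟩)).1.symm

end OfWord

open StdRTableau

variable {r n : ℕ} [Fintype (StdRTableau r n)]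

open Classical in
theorem yamanouchiCount_eq_card (D : Finset ℕ) (lam : Fin r → YoungDiagram)
    (hlam : ∑ i, (lam i).card = n) :
    yamanouchiCount D lam = ({T | T.Des ⊆ D ∧ T.shape = lam} : Finset (StdRTableau r n)).card := by
  symm
  refine Finset.card_nbij (fun T => T.rowWord) (fun T hT => ?_) rowWord_injective.injOn
    fun y hy => ?_
  · obtain ⟨-, hDes, rfl⟩ := Finset.mem_filter.1 hT
    exact Finset.mem_filter.2 ⟨mem_wordsOf.2 T.coe_rowWord, T.descentSet_rowWord ▸ hDes,
      T.isYamanouchi_rowWord⟩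
  · rw [Finset.mem_coe, Finset.mem_filter, mem_wordsOf] at hy
    obtain ⟨hcontent, hDes, hY⟩ := hy
    obtain rfl : y.length = n := by
      rw [← hlam, ← card_rowContent, ← hcontent, Multiset.coe_card]
    obtain ⟨T, hshape, hT⟩ := exists_rowWord_eq hcontent hY
    refine ⟨T, Finset.mem_coe.2 (Finset.mem_filter.2 ⟨Finset.mem_univ _, ?_, hshape⟩), hT⟩
    rwa [← descentSet_rowWord, hT]

theorem wordCount_eq_sum_tableaux (D : Finset ℕ) (m : VarIndex r →₀ ℕ) (hm : m.degree = n) :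
    wordCount D m = ∑ T : StdRTableau r n with T.Des ⊆ D, schurCount T.shape m := by
  classical
  have hmaps (T) (_ : T ∈ ({T | T.Des ⊆ D} : Finset (StdRTableau r n))) :
      T.shape ∈ Fintype.piFinset fun _ : Fin r => cardLE m.degree := by
    rw [Fintype.mem_piFinset, hm]
    exact fun i => mem_cardLE.2 ((Finset.single_le_sum (f := fun i => (T.shape i).card)
      (fun _ _ => Nat.zero_le _) (Finset.mem_univ i)).trans T.sum_card_shape.le)
  rw [wordCount_eq_sum_yamanouchiCount D m le_rfl]
  refine Eq.trans (Finset.sum_congr rfl fun lam _ => ?_)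
    (Finset.sum_fiberwise_of_maps_to' (s := {T : StdRTableau r n | T.Des ⊆ D})
      (g := StdRTableau.shape) (by simpa using hmaps) fun lam => schurCount lam m)
  rw [Finset.sum_const, smul_eq_mul, Finset.filter_filter]
  by_cases hzero : schurCount lam m = 0
  · rw [hzero, mul_zero, mul_zero]
  · rw [yamanouchiCount_eq_card D lam ((sum_card_eq_of_schurCount_ne_zero hzero).trans hm)]

theorem eq_of_sum_powerset_eq {β M : Type*} [AddCancelCommMonoid M] {f g : Finset β → M}
    (h : ∀ D : Finset β, ∑ E ∈ D.powerset, f E = ∑ E ∈ D.powerset, g E) : f = g := by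
  classical
  funext D
  induction D using Finset.strongInduction with
  | H D ih =>
    have hD := h D
    rw [← Finset.sum_erase_add _ _ (Finset.mem_powerset_self D),
      ← Finset.sum_erase_add _ g (Finset.mem_powerset_self D)] at hD
    rw [Finset.sum_congr rfl (g := g)] at hD
    · exact add_left_cancel hD
    · intro E hE
      rw [Finset.mem_erase, Finset.mem_powerset] at hE
      exact ih E (Finset.ssubset_iff_subset_ne.2 ⟨hE.2, hE.1⟩)

theorem sum_powerset_sum_single {ι β M : Type*} [DecidableEq β] [AddCommMonoid M] (s : Finset ι)
    (d : ι → Finset β) (c : ι → M) (D : Finset β) :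
    ∑ E ∈ D.powerset, (∑ t ∈ s, Finsupp.single (d t) (c t)) E = ∑ t ∈ s with d t ⊆ D, c t := by
  simp only [Finsupp.finsetSum_apply, Finsupp.single_apply]
  rw [Finset.sum_comm, Finset.sum_filter]
  simp only [Finset.sum_ite_eq, Finset.mem_powerset]

theorem sum_words_eq_sum_tableaux {M : Type*} [AddCommMonoid M] (F : Finset ℕ → M)
    (m : VarIndex r →₀ ℕ) (hm : m.degree = n) :
    ∑ w ∈ wordsOf (letterContent m), F (descentSet w) =
      ∑ T : StdRTableau r n, schurCount T.shape m • F T.Des := by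
  have hcount : ∑ w ∈ wordsOf (letterContent m), Finsupp.single (descentSet w) 1 =
      ∑ T : StdRTableau r n, Finsupp.single T.Des (schurCount T.shape m) := by
    refine DFunLike.coe_injective (eq_of_sum_powerset_eq fun D => ?_)
    rw [sum_powerset_sum_single, sum_powerset_sum_single, ← wordCount_eq_sum_tableaux D m hm,
      wordCount, Finset.card_eq_sum_ones]
  simpa only [map_sum, Finsupp.linearCombination_single, one_smul]
    using congrArg (Finsupp.linearCombination ℕ F) hcount

end Tableaux

section Compositions

variable {n : ℕ}

/-- The positions `1 ≤ i < n` strictly inside the blocks of a composition of `n`, i.e. those which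
are not a sum of initial parts. -/
def innerPositions (c : Composition n) : Finset ℕ :=
  {i ∈ Finset.Ico 1 n | ∀ j ≤ c.length, i ≠ c.sizeUpTo j}

theorem mem_boundaries_iff_notMem_innerPositions {c : Composition n} {x : Fin (n + 1)} :
    x ∈ c.boundaries ↔ (x : ℕ) ∉ innerPositions c := by
  have hmem : x ∈ c.boundaries ↔ ∃ j ≤ c.length, (x : ℕ) = c.sizeUpTo j := by
    simp only [Composition.boundaries, Finset.mem_map, Finset.mem_univ, true_and, Fin.exists_iff,
      Nat.lt_succ_iff, Fin.ext_iff, eq_comm (a := (x : ℕ))]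
    exact ⟨fun ⟨j, hj, h⟩ => ⟨j, hj, h⟩, fun ⟨j, hj, h⟩ => ⟨j, hj, h⟩⟩
  rw [hmem, innerPositions, Finset.mem_filter, Finset.mem_Ico]
  push Not
  refine ⟨fun h _ => h, fun h => ?_⟩
  by_contra! hne
  have hzero := hne 0 (Nat.zero_le _)
  have hlast := hne c.length le_rfl
  rw [c.sizeUpTo_zero] at hzero
  rw [c.sizeUpTo_length] at hlast
  obtain ⟨j, hj, h⟩ := h ⟨by omega, by omega⟩
  exact hne j hj h

theorem innerPositions_injective : Function.Injective (innerPositions (n := n)) := by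
  intro c c' h
  refine (compositionEquiv n).injective (CompositionAsSet.ext ?_)
  change c.toCompositionAsSet.boundaries = c'.toCompositionAsSet.boundaries
  ext x
  rw [Composition.toCompositionAsSet_boundaries, Composition.toCompositionAsSet_boundaries,
    mem_boundaries_iff_notMem_innerPositions, mem_boundaries_iff_notMem_innerPositions, h]

theorem exists_innerPositions_eq {S : Finset ℕ} (hS : S ⊆ Finset.Ico 1 n) :
    ∃ c : Composition n, innerPositions c = S := by
  let s : CompositionAsSet n :=
    { boundaries := {x | (x : ℕ) ∉ S}
      zero_mem := by simpa using fun h => by simpa using Finset.mem_Ico.1 (hS h)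
      getLast_mem := by simpa using fun h => by simpa using Finset.mem_Ico.1 (hS h) }
  have hiff (x : Fin (n + 1)) : (x : ℕ) ∈ innerPositions s.toComposition ↔ (x : ℕ) ∈ S := by
    rw [← not_iff_not, ← mem_boundaries_iff_notMem_innerPositions,
      CompositionAsSet.toComposition_boundaries, Finset.mem_filter,
      and_iff_right (Finset.mem_univ x)]
  refine ⟨s.toComposition, Finset.Subset.antisymm (fun i hi => ?_) fun i hi => ?_⟩
  · exact (hiff ⟨i, by have := Finset.mem_Ico.1 (Finset.mem_of_mem_filter i hi); omega⟩).1 hi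
  · exact (hiff ⟨i, by have := Finset.mem_Ico.1 (hS hi); omega⟩).2 hi

theorem card_innerPositions_add_length (c : Composition n) :
    (innerPositions c).card + c.length = n := by
  have hmap : innerPositions c = c.boundariesᶜ.map Fin.valEmbedding := by
    ext i
    simp only [Finset.mem_map, Finset.mem_compl, mem_boundaries_iff_notMem_innerPositions, not_not,
      Fin.valEmbedding_apply]
    constructor
    · intro hi
      have hin := (Finset.mem_Ico.1 (Finset.mem_of_mem_filter i hi)).2
      exact ⟨⟨i, hin.trans n.lt_succ_self⟩, hi, rfl⟩
    · rintro ⟨x, hx, rfl⟩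
      exact hx
  have hcard := Finset.card_compl_add_card c.boundaries
  rw [c.card_boundaries_eq_succ_length, Fintype.card_fin] at hcard
  rw [hmap, Finset.card_map]
  omega

theorem mem_innerPositions_iff {c : Composition n} {i : ℕ} :
    i ∈ innerPositions c ↔
      ∃ (b : Fin c.length) (j : ℕ), j + 1 < c.blocksFun b ∧ c.sizeUpTo b + (j + 1) = i := by
  rw [innerPositions, Finset.mem_filter, Finset.mem_Ico]
  constructor
  · rintro ⟨⟨-, hin⟩, hne⟩
    have hle := c.sizeUpTo_index_le ⟨i, hin⟩
    have hlt := c.lt_sizeUpTo_index_succ ⟨i, hin⟩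
    set b := c.index ⟨i, hin⟩
    rw [Fin.val_succ, c.sizeUpTo_succ'] at hlt
    have hne' := hne b b.2.le
    simp only at hle hlt
    exact ⟨b, i - c.sizeUpTo b - 1, by omega, by omega⟩
  · rintro ⟨b, j, hj, rfl⟩
    have hsucc := c.sizeUpTo_succ' b
    have hn := c.sizeUpTo_le (b + 1)
    refine ⟨⟨by omega, by omega⟩, fun t _ heq => ?_⟩
    rcases Nat.lt_or_ge b t with h | h
    · have hmono := c.monotone_sizeUpTo (Nat.succ_le_of_lt h)
      rw [Nat.succ_eq_add_one] at hmono
      omega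
    · have hmono := c.monotone_sizeUpTo h
      omega

theorem getElem?_flatten_sizeUpTo {α : Type*} {L : List (List α)} {c : Composition n}
    (hL : L.map List.length = c.blocks) {b j : ℕ} (hb : b < L.length) (hj : j < L[b].length) :
    L.flatten[c.sizeUpTo b + j]? = some L[b][j] := by
  have hblock := List.drop_take_succ_flatten_eq_getElem L b hb
  rw [hL] at hblock
  change (L.flatten.take (c.sizeUpTo (b + 1))).drop (c.sizeUpTo b) = L[b] at hblock
  rw [← List.getElem?_eq_getElem hj, ← hblock, List.getElem?_drop, List.getElem?_take_of_lt]
  have hsize : c.sizeUpTo (b + 1) = c.sizeUpTo b + L[b].length := by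
    rw [c.sizeUpTo_succ (by simpa [← c.blocks_length, ← hL] using hb)]
    simp [← hL]
  omega

theorem innerPositions_subset_descentSet_flatten_iff {α : Type*} [LinearOrder α]
    {L : List (List α)} {c : Composition n} (hL : L.map List.length = c.blocks) :
    innerPositions c ⊆ descentSet L.flatten ↔ ∀ l ∈ L, l.Pairwise (· > ·) := by
  have hlength : c.length = L.length := by rw [← c.blocks_length, ← hL, List.length_map]
  have hfun (b : Fin c.length) : c.blocksFun b = (L[b]'(hlength ▸ b.2)).length := by
    simp [Composition.blocksFun, ← hL]
  have hdes (b j : ℕ) (hb : b < L.length) (hj : j + 1 < L[b].length) :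
      c.sizeUpTo b + (j + 1) ∈ descentSet L.flatten ↔ L[b][j + 1] < L[b][j] := by
    obtain ⟨h, heq⟩ := List.getElem?_eq_some_iff.1 (getElem?_flatten_sizeUpTo hL hb hj)
    obtain ⟨h', heq'⟩ :=
      List.getElem?_eq_some_iff.1 (getElem?_flatten_sizeUpTo hL hb (Nat.lt_of_succ_lt hj))
    rw [← heq, ← heq', mem_descentSet]
    exact ⟨fun ⟨_, _, hlt⟩ => hlt, fun hlt => ⟨by omega, h, hlt⟩⟩
  simp only [List.forall_mem_iff_getElem, ← List.isChain_iff_pairwise, List.isChain_iff_getElem]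
  constructor
  · intro h b hb j hj
    refine (hdes b j hb hj).1 (h (mem_innerPositions_iff.2 ⟨⟨b, hlength ▸ hb⟩, j, ?_, rfl⟩))
    rwa [hfun]
  · intro h i hi
    obtain ⟨b, j, hj, rfl⟩ := mem_innerPositions_iff.1 hi
    rw [hfun] at hj
    exact (hdes b j (hlength ▸ b.2) hj).2 (h b _ j hj)

end Compositions

theorem wordDes_eq_descentSet {r : ℕ} (w : List (ColoredLetter r)) :
    wordDes w = descentSet w := by
  classical
  ext i
  rw [wordDes, Finset.mem_filter, Finset.mem_Ico, mem_descentSet]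
  constructor
  · rintro ⟨⟨h1, h2⟩, a, b, ha, hb, hlt⟩
    obtain ⟨_, rfl⟩ := List.getElem?_eq_some_iff.1 ha
    obtain ⟨_, rfl⟩ := List.getElem?_eq_some_iff.1 hb
    exact ⟨h1, h2, hlt⟩
  · rintro ⟨h1, h2, hlt⟩
    exact ⟨⟨h1, h2⟩, _, _, List.getElem?_eq_getElem (by omega), List.getElem?_eq_getElem h2, hlt⟩

/-- The sum of the colors of the letters in a word whose letters have multiplicities `m`. -/
noncomputable def colorWeight {r : ℕ} (m : VarIndex r →₀ ℕ) : ℕ :=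
  Finsupp.linearCombination ℕ (fun p : VarIndex r => (p.1 : ℕ)) m

/-- The generating polynomial of the major index over all choices of `j` stars among the descents
`D` of a word whose colors add up to `c`. -/
noncomputable def starPoly (c r j : ℕ) (D : Finset ℕ) : ℕ[X] :=
  ∑ S ∈ D.powersetCard j, X ^ (c + r * (∑ i ∈ D, i - ∑ i ∈ S, {d ∈ D | i ≤ d}.card))

theorem coeff_starPoly (c r j : ℕ) (D : Finset ℕ) (d : ℕ) :
    (starPoly c r j D).coeff d =
      {S ∈ D.powersetCard j |
        c + r * (∑ i ∈ D, i - ∑ i ∈ S, {d ∈ D | i ≤ d}.card) = d}.card := by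
  simp only [starPoly, finsetSum_coeff, coeff_X_pow, Finset.card_filter, eq_comm (a := d)]

namespace ColoredOMP

variable {r n k : ℕ}

theorem colorSum_eq (μ : ColoredOMP r n k) : μ.colorSum = colorWeight μ.weight := by
  simp [colorSum, colorWeight, weight, map_sum]

theorem degree_weight (μ : ColoredOMP r n k) : μ.weight.degree = n := by
  simp [weight, map_sum, Finsupp.degree_single, μ.size]

/-- The blocks of `μ`, each written as a decreasing word. -/
def blockWords (μ : ColoredOMP r n k) : List (List (ColoredLetter r)) :=
  List.ofFn fun i => (μ.block i).sort (fun a b => b ≤ a)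

theorem word_eq_flatten (μ : ColoredOMP r n k) : μ.word = μ.blockWords.flatten := rfl

theorem blockWords_injective : Function.Injective (blockWords (r := r) (n := n) (k := k)) := by
  rintro ⟨b, hb, hs⟩ ⟨b', hb', hs'⟩ h
  obtain rfl : b = b' := by
    funext i
    have hsort := congrArg List.toFinset (congrFun (List.ofFn_injective h) i)
    rwa [Finset.sort_toFinset, Finset.sort_toFinset] at hsort
  rfl

theorem coe_word (μ : ColoredOMP r n k) :
    (μ.word : Multiset (ColoredLetter r)) = letterContent μ.weight := by
  let content : (VarIndex r →₀ ℕ) →+ Multiset (ColoredLetter r) :=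
    (Multiset.mapAddMonoidHom (letterEquiv r).symm).comp Finsupp.toMultiset
  have hsingle (a : ColoredLetter r) : content (Finsupp.single (a.color, a.value) 1) = {a} := by
    simp only [content, AddMonoidHom.comp_apply]
    change Multiset.map _ (Finsupp.toMultiset _) = _
    rw [Finsupp.toMultiset_single, one_smul, Multiset.map_singleton]
    exact congrArg _ ((letterEquiv r).symm_apply_apply a)
  change _ = content μ.weight
  simp only [weight, map_sum, hsingle, Finset.sum_multiset_singleton]
  rw [word_eq_flatten, ← Multiset.coe_join, Multiset.join, Multiset.sum_coe, blockWords,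
    List.map_ofFn, List.sum_ofFn]
  exact Finset.sum_congr rfl fun i _ => Finset.sort_eq _ _

/-- The composition of `n` formed by the sizes of the blocks. -/
def composition (μ : ColoredOMP r n k) : Composition n where
  blocks := List.ofFn fun i => (μ.block i).card
  blocks_pos := by
    intro x hx
    obtain ⟨i, rfl⟩ := List.mem_ofFn.1 hx
    exact (μ.nonempty i).card_pos
  blocks_sum := by rw [List.sum_ofFn, μ.size]

theorem length_composition (μ : ColoredOMP r n k) : μ.composition.length = k :=
  List.length_ofFn

theorem map_length_blockWords (μ : ColoredOMP r n k) :
    μ.blockWords.map List.length = μ.composition.blocks := by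
  simp only [blockWords, composition, List.map_ofFn, Function.comp_def, Finset.length_sort]

theorem stars_eq (μ : ColoredOMP r n k) : μ.stars = innerPositions μ.composition := by
  classical
  simp only [innerPositions, length_composition]
  simp only [stars, Composition.sizeUpTo, composition, List.sum_take_ofFn]

theorem card_stars_add (μ : ColoredOMP r n k) : μ.stars.card + k = n := by
  have hcard := card_innerPositions_add_length μ.composition
  rwa [← stars_eq, length_composition] at hcard

theorem stars_subset_descentSet (μ : ColoredOMP r n k) : μ.stars ⊆ descentSet μ.word := by
  rw [stars_eq, word_eq_flatten,
    innerPositions_subset_descentSet_flatten_iff μ.map_length_blockWords, blockWords,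
    List.forall_mem_ofFn_iff]
  exact fun i => (Finset.sortedGT_sort _).pairwise

theorem eq_of_word_stars {μ μ' : ColoredOMP r n k} (hword : μ.word = μ'.word)
    (hstars : μ.stars = μ'.stars) : μ = μ' := by
  rw [stars_eq, stars_eq] at hstars
  refine blockWords_injective (List.eq_iff_flatten_eq.2 ⟨hword, ?_⟩)
  rw [map_length_blockWords, map_length_blockWords, innerPositions_injective hstars]

theorem exists_blockWords_eq {L : List (List (ColoredLetter r))}
    (hsort : ∀ l ∈ L, l.Pairwise (· > ·)) (hne : ∀ l ∈ L, l ≠ []) (hn : L.flatten.length = n)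
    (hk : L.length = k) : ∃ μ : ColoredOMP r n k, μ.blockWords = L := by
  subst hk
  have hblock (l) (hl : l ∈ L) : l.toFinset.sort (fun a b => b ≤ a) = l :=
    (List.toFinset_sort _ ((hsort l hl).imp ne_of_gt)).2 ((hsort l hl).imp le_of_lt)
  have hcard (l) (hl : l ∈ L) : l.toFinset.card = l.length := by
    rw [← Finset.length_sort (fun a b => b ≤ a), hblock l hl]
  refine ⟨⟨fun i => L[i].toFinset, fun i => ?_, ?_⟩, ?_⟩
  · exact List.toFinset_nonempty_iff _ |>.2 (hne _ (List.getElem_mem _))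
  · rw [← hn, List.length_flatten, ← List.map_congr_left hcard]
    exact Fin.sum_univ_fun_getElem L fun l => l.toFinset.card
  · exact (List.ofFn_getElem_eq_map L fun l => l.toFinset.sort (fun a b => b ≤ a)).trans
      ((List.map_congr_left hblock).trans L.map_id')

theorem exists_word_stars {w : List (ColoredLetter r)} {S : Finset ℕ} (hw : w.length = n)
    (hS : S ⊆ descentSet w) (hcard : S.card + k = n) :
    ∃ μ : ColoredOMP r n k, μ.word = w ∧ μ.stars = S := by
  subst hw
  obtain ⟨c, rfl⟩ := exists_innerPositions_eq (n := w.length) (S := S) fun i hi => by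
    obtain ⟨h1, h2, -⟩ := mem_descentSet.1 (hS hi)
    exact Finset.mem_Ico.2 ⟨h1, h2⟩
  have hblocks := List.map_length_splitWrtComposition w c
  have hflat := List.flatten_splitWrtComposition w c
  have hlength := card_innerPositions_add_length c
  obtain ⟨μ, hμ⟩ := exists_blockWords_eq (n := w.length) (k := k) (L := w.splitWrtComposition c)
    ((innerPositions_subset_descentSet_flatten_iff hblocks).1 (by rwa [hflat]))
    (fun l hl => List.ne_nil_of_length_pos (List.length_pos_of_mem_splitWrtComposition hl))
    (by rw [hflat]) (by rw [List.length_splitWrtComposition]; omega)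
  refine ⟨μ, by rw [word_eq_flatten, hμ, hflat], ?_⟩
  rw [stars_eq, show μ.composition = c from
    Composition.ext (by rw [← map_length_blockWords, hμ, hblocks])]

theorem card_maj_weight (m : VarIndex r →₀ ℕ) (d : ℕ) (hm : m.degree = n) (hkn : k ≤ n) :
    Nat.card {μ : ColoredOMP r n k // μ.maj = d ∧ μ.weight = m} =
      ∑ w ∈ wordsOf (letterContent m),
        (starPoly (colorWeight m) r (n - k) (descentSet w)).coeff d := by
  simp only [coeff_starPoly]
  rw [← Finset.card_sigma, ← Nat.card_eq_finsetCard]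
  refine Nat.card_eq_of_bijective (fun μ => ⟨⟨μ.1.word, μ.1.stars⟩, ?_⟩) ⟨?_, ?_⟩
  · obtain ⟨μ, hmaj, rfl⟩ := μ
    have hcard := μ.card_stars_add
    rw [maj, wordDes_eq_descentSet, colorSum_eq] at hmaj
    simp only [Finset.mem_sigma, mem_wordsOf, Finset.mem_filter, Finset.mem_powersetCard]
    exact ⟨μ.coe_word, ⟨μ.stars_subset_descentSet, by omega⟩, hmaj⟩
  · rintro ⟨μ, _⟩ ⟨μ', _⟩ h
    simp only [Subtype.mk.injEq, Sigma.mk.injEq, heq_eq_eq] at h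
    exact Subtype.ext (eq_of_word_stars h.1 h.2)
  · rintro ⟨⟨w, S⟩, h⟩
    simp only [Finset.mem_sigma, mem_wordsOf, Finset.mem_filter, Finset.mem_powersetCard] at h
    obtain ⟨hw, ⟨hS, hcard⟩, hmaj⟩ := h
    obtain ⟨μ, rfl, rfl⟩ := exists_word_stars (n := n) (k := k)
      (by rw [← Multiset.coe_card, hw, card_letterContent, hm]) hS (by omega)
    obtain rfl : μ.weight = m := letterContent_injective (by rw [← coe_word, hw])
    refine ⟨⟨μ, ?_, rfl⟩, rfl⟩
    rwa [maj, wordDes_eq_descentSet, colorSum_eq]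

end ColoredOMP

section QBinomial

/-- The Gaussian binomial coefficients as polynomials with natural number coefficients, defined by
the `q`-Pascal rule. -/
noncomputable def gaussPoly : ℕ → ℕ → ℕ[X]
  | _, 0 => 1
  | 0, _ + 1 => 0
  | d + 1, m + 1 => gaussPoly d (m + 1) + X ^ (d - m) * gaussPoly d m

theorem gaussPoly_zero_right (d : ℕ) : gaussPoly d 0 = 1 := by
  cases d <;> rfl

theorem gaussPoly_succ_succ (d m : ℕ) :
    gaussPoly (d + 1) (m + 1) = gaussPoly d (m + 1) + X ^ (d - m) * gaussPoly d m := rfl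

theorem gaussPoly_eq_zero {d m : ℕ} (h : d < m) : gaussPoly d m = 0 := by
  induction d generalizing m with
  | zero =>
    obtain ⟨m, rfl⟩ := Nat.exists_eq_succ_of_ne_zero h.ne'
    rfl
  | succ d ih =>
    obtain ⟨m, rfl⟩ := Nat.exists_eq_succ_of_ne_zero (Nat.ne_zero_of_lt h)
    rw [gaussPoly_succ_succ, ih (by omega), ih (by omega), mul_zero, add_zero]

theorem qInt_add (a b : ℕ) : qInt (a + b) = qInt a + X ^ a * qInt b := by
  simp only [qInt, Finset.sum_range_add, Finset.mul_sum, pow_add]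

theorem qFact_succ (m : ℕ) : qFact (m + 1) = qFact m * qInt (m + 1) :=
  Finset.prod_range_succ _ _

theorem qFact_ne_zero (m : ℕ) : qFact m ≠ 0 := by
  refine Finset.prod_ne_zero_iff.2 fun i _ h => i.cast_add_one_ne_zero (R := ℚ) ?_
  simpa [qInt, eval_finsetSum] using congrArg (eval 1) h

theorem map_gaussPoly_mul_qFact {d m : ℕ} (h : m ≤ d) :
    (gaussPoly d m).map (Nat.castRingHom ℚ) * (qFact m * qFact (d - m)) = qFact d := by
  induction d generalizing m with
  | zero =>
    obtain rfl := Nat.le_zero.1 h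
    simp [gaussPoly_zero_right, qFact]
  | succ d ih =>
    rcases m with - | m
    · simp [gaussPoly_zero_right, qFact]
    have hm : m ≤ d := Nat.le_of_succ_le_succ h
    have hfirst : (gaussPoly d (m + 1)).map (Nat.castRingHom ℚ) * (qFact (m + 1) * qFact (d - m)) =
        qFact d * qInt (d - m) := by
      rcases hm.eq_or_lt with rfl | hlt
      · simp [gaussPoly_eq_zero, qInt]
      · rw [← ih hlt, show d - m = d - (m + 1) + 1 by omega, qFact_succ (d - (m + 1))]
        ring
    have hsecond : X ^ (d - m) * (gaussPoly d m).map (Nat.castRingHom ℚ) *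
        (qFact (m + 1) * qFact (d - m)) = qFact d * (X ^ (d - m) * qInt (m + 1)) := by
      rw [← ih hm, qFact_succ m]
      ring
    rw [gaussPoly_succ_succ, Polynomial.map_add, Polynomial.map_mul, Polynomial.map_pow, map_X,
      add_mul, Nat.succ_sub_succ, hfirst, hsecond, ← mul_add, ← qInt_add, qFact_succ,
      show d - m + (m + 1) = d + 1 by omega]

theorem map_gaussPoly (d m : ℕ) : (gaussPoly d m).map (Nat.castRingHom ℚ) = qBinom d m := by
  rw [qBinom]
  split_ifs with h
  · rw [← map_gaussPoly_mul_qFact h,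
      mul_div_cancel_right₀ _ (mul_ne_zero (qFact_ne_zero _) (qFact_ne_zero _))]
  · rw [gaussPoly_eq_zero (not_le.1 h), Polynomial.map_zero]

theorem sum_powersetCard_succ_insert {α M : Type*} [DecidableEq α] [AddCommMonoid M] {a : α}
    {D : Finset α} (ha : a ∉ D) (j : ℕ) (f : Finset α → M) :
    ∑ S ∈ (insert a D).powersetCard (j + 1), f S =
      ∑ S ∈ D.powersetCard (j + 1), f S + ∑ S ∈ D.powersetCard j, f (insert a S) := by
  rw [Finset.powersetCard_succ_insert ha, Finset.sum_union, Finset.sum_image]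
  · intro S hS S' hS' h
    rw [Finset.mem_coe, Finset.mem_powersetCard] at hS hS'
    rw [← Finset.erase_insert fun h => ha (hS.1 h), h, Finset.erase_insert fun h => ha (hS'.1 h)]
  · rw [Finset.disjoint_left]
    intro S hS hS'
    obtain ⟨S', _, rfl⟩ := Finset.mem_image.1 hS'
    exact ha ((Finset.mem_powersetCard.1 hS).1 (Finset.mem_insert_self a S'))

theorem sum_powersetCard_X_pow_card_lt (D : Finset ℕ) (j : ℕ) :
    ∑ S ∈ D.powersetCard j, (X : ℕ[X]) ^ ∑ i ∈ S, {d ∈ D | d < i}.card =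
      X ^ j.choose 2 * gaussPoly D.card j := by
  induction D using Finset.induction_on_max generalizing j with
  | empty => rcases j with - | j <;> simp [gaussPoly]
  | insert a D hlt ih =>
    rcases j with - | j
    · simp [gaussPoly_zero_right]
    have ha : a ∉ D := fun h => (hlt a h).false
    have hrank {S : Finset ℕ} (hS : S ⊆ D) :
        ∑ i ∈ S, {d ∈ insert a D | d < i}.card = ∑ i ∈ S, {d ∈ D | d < i}.card :=
      Finset.sum_congr rfl fun i hi => by rw [Finset.filter_insert, if_neg (hlt i (hS hi)).not_gt]
    have htop : {d ∈ insert a D | d < a} = D := by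
      rw [Finset.filter_insert, if_neg (lt_irrefl a), Finset.filter_true_of_mem hlt]
    have hsum : ∑ S ∈ D.powersetCard j,
        (X : ℕ[X]) ^ ∑ i ∈ insert a S, {d ∈ insert a D | d < i}.card =
          X ^ D.card * (X ^ j.choose 2 * gaussPoly D.card j) := by
      rw [← ih, Finset.mul_sum]
      refine Finset.sum_congr rfl fun S hS => ?_
      have hSD := (Finset.mem_powersetCard.1 hS).1
      rw [Finset.sum_insert fun h => ha (hSD h), htop, hrank hSD, pow_add]
    rw [sum_powersetCard_succ_insert ha, hsum,
      Finset.sum_congr rfl fun S hS => by rw [hrank (Finset.mem_powersetCard.1 hS).1], ih,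
      Finset.card_insert_of_notMem ha, gaussPoly_succ_succ, mul_add, ← mul_assoc, ← mul_assoc,
      ← pow_add, ← pow_add, Nat.choose_succ_succ', Nat.choose_one_right]
    rcases Nat.lt_or_ge D.card j with h | h
    · simp [gaussPoly_eq_zero h]
    · rw [show j + j.choose 2 + (D.card - j) = D.card + j.choose 2 by omega]

theorem sum_card_filter_le_add_sum_card_filter_lt (D S : Finset ℕ) :
    ∑ i ∈ S, {d ∈ D | i ≤ d}.card + ∑ i ∈ S, {d ∈ D | d < i}.card = S.card * D.card := by
  rw [← Finset.sum_add_distrib, ← smul_eq_mul, ← Finset.sum_const]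
  refine Finset.sum_congr rfl fun i _ => ?_
  simpa only [not_le] using Finset.card_filter_add_card_filter_not (s := D) (i ≤ ·)

theorem sum_card_filter_le_le_sum {D S : Finset ℕ} (hD : 0 ∉ D) (hS : S ⊆ D) :
    ∑ i ∈ S, {d ∈ D | i ≤ d}.card ≤ ∑ i ∈ D, i := by
  refine (Finset.sum_card_bipartiteAbove_eq_sum_card_bipartiteBelow (· ≤ ·)).trans_le
    (Finset.sum_le_sum fun d _ => ?_)
  have hsub : S.bipartiteBelow (· ≤ ·) d ⊆ Finset.Icc 1 d := fun i hi => by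
    obtain ⟨hiS, hid⟩ := (Finset.mem_bipartiteBelow _).1 hi
    exact Finset.mem_Icc.2 ⟨Nat.pos_of_ne_zero fun h => hD (h ▸ hS hiS), hid⟩
  simpa using Finset.card_le_card hsub

theorem choose_two_card_add_one_le_sum {D : Finset ℕ} (hD : 0 ∉ D) :
    (D.card + 1).choose 2 ≤ ∑ i ∈ D, i := by
  induction D using Finset.induction_on_max with
  | empty => simp
  | insert a D hlt ih =>
    have ha : a ∉ D := fun h => (hlt a h).false
    have hD' : 0 ∉ D := fun h => hD (Finset.mem_insert_of_mem h)
    have hsub : D ⊆ Finset.Ico 1 a := fun d hd =>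
      Finset.mem_Ico.2 ⟨Nat.pos_of_ne_zero fun h => hD' (h ▸ hd), hlt d hd⟩
    have hcard := Finset.card_le_card hsub
    have hpos : a ≠ 0 := fun h => hD (h ▸ Finset.mem_insert_self a D)
    rw [Nat.card_Ico] at hcard
    rw [Finset.card_insert_of_notMem ha, Finset.sum_insert ha, Nat.choose_succ_succ',
      Nat.choose_one_right]
    exact Nat.add_le_add (by omega) (ih hD')

theorem mul_le_choose_two_add_choose_two (j l : ℕ) : j * l ≤ (l + 1).choose 2 + j.choose 2 := by
  have hnonneg : 0 ≤ ((l : ℤ) - j) * (l - j + 1) := by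
    rcases le_or_gt 0 ((l : ℤ) - j) with h | h
    · positivity
    · exact mul_nonneg_of_nonpos_of_nonpos h.le (Int.add_one_le_of_lt h)
  have hnonneg' : 0 ≤ ((l : ℚ) - j) * (l - j + 1) := by exact_mod_cast hnonneg
  qify
  rw [Nat.cast_choose_two, Nat.cast_choose_two]
  push_cast
  linarith

theorem starPoly_eq {D : Finset ℕ} (hD : 0 ∉ D) (c r j : ℕ) :
    starPoly c r j D = X ^ (c + r * ∑ i ∈ D, i + r * j.choose 2 - r * j * D.card) *
      (gaussPoly D.card j).comp (X ^ r) := by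
  have hterm (S) (hS : S ∈ D.powersetCard j) : (X : ℕ[X]) ^ (r * (j * D.card)) *
      X ^ (c + r * (∑ i ∈ D, i - ∑ i ∈ S, {d ∈ D | i ≤ d}.card)) =
        X ^ (c + r * ∑ i ∈ D, i) * (X ^ ∑ i ∈ S, {d ∈ D | d < i}.card).comp (X ^ r) := by
    obtain ⟨hSD, rfl⟩ := Finset.mem_powersetCard.1 hS
    obtain ⟨t, ht⟩ := Nat.exists_eq_add_of_le (sum_card_filter_le_le_sum hD hSD)
    rw [← sum_card_filter_le_add_sum_card_filter_lt, ht, Nat.add_sub_cancel_left, X_pow_comp]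
    ring
  have hle : r * j * D.card ≤ r * ∑ i ∈ D, i + r * j.choose 2 := by
    rw [mul_assoc, ← mul_add]
    exact Nat.mul_le_mul_left r ((mul_le_choose_two_add_choose_two j D.card).trans
      (Nat.add_le_add_right (choose_two_card_add_one_le_sum hD) _))
  refine (isRegular_X_pow (r * (j * D.card))).left ?_
  simp only [starPoly]
  rw [Finset.mul_sum, Finset.sum_congr rfl hterm, ← Finset.mul_sum, ← Polynomial.sum_comp,
    sum_powersetCard_X_pow_card_lt, mul_comp, X_pow_comp, ← pow_mul, ← mul_assoc, ← mul_assoc,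
    ← pow_add, ← pow_add]
  congr 2
  rw [← mul_assoc]
  omega

end QBinomial

section Expansion

variable {r n : ℕ}

theorem exists_tableauWeight_eq_of_schurCount_ne_zero {lam : Fin r → YoungDiagram}
    {m : VarIndex r →₀ ℕ} (h : schurCount lam m ≠ 0) :
    ∃ T : ∀ i, SemistandardYoungTableau (lam i), tableauWeight T = m := by
  have hcomp (i : Fin r) : ∃ T : SemistandardYoungTableau (lam i), entryWeight T = m.curry i :=
    nonempty_subtype.1 (Nat.card_ne_zero.1 (Finset.prod_ne_zero_iff.1 h i (Finset.mem_univ i))).1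
  choose T hT using hcomp
  exact ⟨T, tableauWeight_eq_iff.2 hT⟩

theorem colorWeight_tableauWeight {lam : Fin r → YoungDiagram}
    (T : ∀ i, SemistandardYoungTableau (lam i)) :
    colorWeight (tableauWeight T) = ∑ i : Fin r, (i : ℕ) * (lam i).card := by
  simp [colorWeight, tableauWeight, map_sum, mul_comm]

/-- `tableauPoly` with natural number coefficients, as the generating polynomial of the choices of
`n - k` stars among the descents of `T`. -/
noncomputable def tableauStarPoly (k : ℕ) (T : StdRTableau r n) : ℕ[X] :=
  starPoly (∑ i : Fin r, (i : ℕ) * (T.shape i).card) r (n - k) T.Des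

theorem map_tableauStarPoly (k : ℕ) (T : StdRTableau r n) :
    (tableauStarPoly k T).map (Nat.castRingHom ℚ) = tableauPoly k T := by
  classical
  have hzero : 0 ∉ T.Des := by simp [StdRTableau.Des]
  rw [tableauStarPoly, starPoly_eq hzero, Polynomial.map_mul, Polynomial.map_pow, map_X, map_comp,
    Polynomial.map_pow, map_X, map_gaussPoly, tableauPoly, StdRTableau.maj, StdRTableau.des,
    add_comm (r * _)]

theorem card_maj_weight_eq_sum_tableaux [Fintype (StdRTableau r n)] {k : ℕ} (hkn : k ≤ n) (d : ℕ)
    (m : VarIndex r →₀ ℕ) :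
    Nat.card {μ : ColoredOMP r n k // μ.maj = d ∧ μ.weight = m} =
      ∑ T : StdRTableau r n, schurCount T.shape m * (tableauStarPoly k T).coeff d := by
  by_cases hm : m.degree = n
  · rw [ColoredOMP.card_maj_weight m d hm hkn,
      sum_words_eq_sum_tableaux (fun D => (starPoly (colorWeight m) r (n - k) D).coeff d) m hm]
    refine Finset.sum_congr rfl fun T _ => ?_
    by_cases hT : schurCount T.shape m = 0
    · rw [hT, zero_smul, zero_mul]
    · obtain ⟨U, rfl⟩ := exists_tableauWeight_eq_of_schurCount_ne_zero hT
      rw [colorWeight_tableauWeight, smul_eq_mul, tableauStarPoly]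
  · have hempty : IsEmpty {μ : ColoredOMP r n k // μ.maj = d ∧ μ.weight = m} :=
      ⟨fun μ => hm (μ.2.2 ▸ μ.1.degree_weight)⟩
    rw [Nat.card_of_isEmpty]
    refine (Finset.sum_eq_zero fun T _ => mul_eq_zero_of_left ?_ _).symm
    by_contra hT
    exact hm ((sum_card_eq_of_schurCount_ne_zero hT).symm.trans T.sum_card_shape)

theorem MCoeff_eq_sum [Fintype (StdRTableau r n)] {k : ℕ} (hkn : k ≤ n) (d : ℕ) :
    MCoeff r n k d = ∑ T : StdRTableau r n, (tableauPoly k T).coeff d • schur T.shape := by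
  refine MvPowerSeries.ext fun m => ?_
  change (Nat.card {μ : ColoredOMP r n k // μ.maj = d ∧ μ.weight = m} : ℚ) = _
  simp [card_maj_weight_eq_sum_tableaux hkn, coeff_schur, ← map_tableauStarPoly, mul_comm]

theorem coeff_sum_map_mul_C {ι R A : Type*} [CommSemiring R] [Semiring A] [Algebra R A]
    (s : Finset ι) (p : ι → R[X]) (a : ι → A) (d : ℕ) :
    (∑ t ∈ s, (p t).map (algebraMap R A) * C (a t)).coeff d = ∑ t ∈ s, (p t).coeff d • a t := by
  simp only [finsetSum_coeff, coeff_mul_C, coeff_map, Algebra.smul_def]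

theorem coeff_MSeries [Fintype (StdRTableau r n)] {k : ℕ} (hkn : k ≤ n) (d : ℕ) :
    (MSeries r n k).coeff d =
      ∑ T : StdRTableau r n, (tableauPoly k T).coeff d • schur T.shape := by
  set P := ∑ T : StdRTableau r n,
    (tableauPoly k T).map (algebraMap ℚ (MvPowerSeries (VarIndex r) ℚ)) * C (schur T.shape)
  have hcoeff (d : ℕ) : MCoeff r n k d = P.coeff d := by
    rw [coeff_sum_map_mul_C, MCoeff_eq_sum hkn]
  have hP : MSeries r n k = P := by
    simp only [MSeries, hcoeff]
    rw [finsum_eq_sum_of_support_subset (s := P.support), ← P.as_sum_support]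
    exact fun d hd => mem_support_iff.2 fun h => hd (by simp only [h, monomial_zero_right])
  rw [hP, coeff_sum_map_mul_C]

theorem coeff_tableauSum [Fintype (StdRTableau r n)] (k d : ℕ) :
    (tableauSum r n k).coeff d =
      ∑ T : StdRTableau r n, (tableauPoly k T).coeff d • schur (conj T.shape) := by
  rw [tableauSum, finsum_eq_sum_of_fintype, coeff_sum_map_mul_C]

theorem omegaSeries_zero (r : ℕ) : omegaSeries r 0 = 0 := by
  rw [omegaSeries, dif_pos (SymmR r).zero_mem]
  exact congrArg Subtype.val (map_zero (omega r))

theorem coeff_omegaQ (P : (MvPowerSeries (VarIndex r) ℚ)[X]) (d : ℕ) :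
    (omegaQ r P).coeff d = omegaSeries r (P.coeff d) := by
  simp only [omegaQ, finsetSum_coeff, coeff_monomial, Finset.sum_ite_eq']
  split_ifs with h
  · rfl
  · rw [notMem_support_iff.1 h, omegaSeries_zero]

theorem omegaQ_MSeries {k : ℕ} (hkn : k ≤ n) : omegaQ r (MSeries r n k) = tableauSum r n k := by
  let _ := Fintype.ofFinite (StdRTableau r n)
  ext1 d
  rw [coeff_omegaQ, coeff_MSeries hkn, omegaSeries_sum_smul_schur, coeff_tableauSum]

theorem schurPositive_revQ_tableauSum (r n k : ℕ) : SchurPositive (revQ (tableauSum r n k)) := by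
  classical
  let _ := Fintype.ofFinite (StdRTableau r n)
  set N := (tableauSum r n k).natDegree with hN
  refine ⟨∑ T : StdRTableau r n,
    Finsupp.single (conj T.shape) (reflect N (tableauStarPoly k T)), ?_⟩
  rw [← Finsupp.sum_finsetSum_index (by simp) fun lam p p' => by rw [Polynomial.map_add, add_mul]]
  ext1 d
  rw [revQ, reverse, coeff_reflect, ← hN, coeff_tableauSum, finsetSum_coeff]
  refine Finset.sum_congr rfl fun T _ => ?_
  rw [Finsupp.sum_single_index (by simp), coeff_mul_C, coeff_map, coeff_reflect,
    ← map_tableauStarPoly, coeff_map]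
  simp [Algebra.smul_def]

end Expansion

theorem mainTheorem10 (r n k : ℕ) (hr : 1 ≤ r) (hk : 1 ≤ k) (hkn : k ≤ n) :
    (∀ d : ℕ, (MSeries r n k).coeff d ∈ SymmR r) ∧
      DSeries r n k = revQ (tableauSum r n k) ∧
      SchurPositive (DSeries r n k) := by
  let _ := Fintype.ofFinite (StdRTableau r n)
  have hD : DSeries r n k = revQ (tableauSum r n k) := by rw [DSeries, omegaQ_MSeries hkn]
  refine ⟨fun d => ?_, hD, hD ▸ schurPositive_revQ_tableauSum r n k⟩
  rw [coeff_MSeries hkn]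
  exact Submodule.sum_mem _ fun T _ => Submodule.smul_mem _ _ (schur_mem_SymmR _)
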